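/- **Setting.** Let $n\ge 1$, $p\ge 1$, $L\ge 2$. Let $(X,Y)$ be a random pair with $X\in\mathbb R^p$, $\mathbb E X=0$, and $Y\in\{\mathbf e_1,\dots,\mathbf e_L\}$, the canonical basis of $\mathbb R^L$, with $\pi_\ell=\mathbb P\{Y=\mathbf e_\ell\}>0$ and $X\mid Y=\mathbf e_\ell\sim\mathcal N_p(\mu_\ell,\Sigma_W)$ for all $\ell\in[L]$, where $\Sigma_W$ is positive definite. Put $M=(\mu_1,\dots,\mu_L)$, $B^*=\Sigma_W^{-1}M$ and $B=[\mathrm{Cov}(X)]^{-1}\mathrm{Cov}(X,Y)\in\mathbb R^{p\times L}$. Let $(X_1,Y_1),\dots,(X_n,Y_n)$ be i.i.d. copies of $(X,Y)$, let $\mathbf X\in\mathbb R^{n\times p}$ and $\mathbf Y\in\mathbb R^{n\times L}$ be the matrices with rows $X_i^\top$ and $Y_i^\top$, and put $\widehat M=(\widehat\mu_1,\dots,\widehat\mu_L)=\mathbf X^\top\mathbf Y(\mathbf Y^\top\mathbf Y)^{-1}$. For an estimator $\widehat B$ of $B$, put $$\widehat H=\tfrac1n\bigl(\mathbf Y^\top\mathbf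 Y-\widehat B^\top\mathbf X^\top\mathbf X\widehat B\bigr),\qquad \widehat B^*=\widehat B\widehat H^{+},$$ where $^+$ is the Moore–Penrose inverse, and, for a number $\Delta>0$, $$\mathcal Q(\widehat B^*)=\|\Sigma_W^{1/2}(\widehat B^*-B^*)\|_F^2\,(\Delta+\log n)+\sum_{\ell=1}^L\bigl[(\widehat\mu_\ell-\mu_\ell)^\top(\widehat B^*_\ell-B^*_\ell)\bigr]^2,$$ where the subscript $\ell$ denotes the $\ell$-th column. Write $\|A\|_{1,2}=\sum_i\|A_{i\cdot}\|_2$ for the sum of the Euclidean norms of the rows of $A$. **Theorem.** Let positive constants $c_\pi\le C_\pi$, $c_s\le C_s$, $c_\Delta\le C_\Delta$, $c_W\le C_W$ be given. There are constants $c>0$ and $C>0$, depending only on these eight constants, such that the following holds for all $n,p,L$ and all distributions of $(X,Y)$ as above. Assume that 1. $c_\pi/L\le\pi_\ell\le C_\pi/L$ for all $\ell\in[L]$; 2. $c_s\Delta\le(\mu_k-\mu_\ell)^\top\Sigma_W^{-1}(\mu_k-\mu_\ell)\le C_s\Delta$ for all $k\ne\ell$, and $c_\Delta\le\Delta\le C_\Delta$;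 3. the smallest eigenvalue of $\Sigma_W$ is greater than $c_W$, and all entries of $\Sigma_W$ are at most $C_W$ in absolute value; 4. $L\log n\le c\,n$. Let $\omega_1,\omega_2$ be deterministic numbers with $\omega_2\sqrt L\le c$ and let $\widehat B$ be any estimator of $B$ such that, with probability at least $1-n^{-1}$, $$\max\bigl\{n^{-1/2}\|\mathbf X(\widehat B-B)\|_F,\ \|\Sigma_W^{1/2}(\widehat B-B)\|_F\bigr\}\le\omega_2\quad\text{and}\quad\|\widehat B-B\|_{1,2}\le\omega_1 .$$ Then, with probability at least $1-2n^{-1}$, the matrix $\widehat H$ is invertible and $$\mathcal Q(\widehat B^*)\le C\left\{\frac{L^2\log^2 n}{n}+\omega_2^2L^2\log n+\omega_1^2L^3\,\frac{\log(n\vee p)}{n}\right\}.$$ -/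

import Mathlib

open MeasureTheory ProbabilityTheory Matrix
open scoped MatrixOrder

namespace LDARegression

/-! ### Matrix notions -/

section MatrixNotions

variable {ι κ : Type*} [Fintype ι] [Fintype κ]

/-- The Frobenius norm `‖A‖_F`. -/
noncomputable def frobNorm (A : Matrix ι κ ℝ) : ℝ :=
  Real.sqrt (∑ i, ∑ j, A i j ^ 2)

/-- The `ℓ₁/ℓ₂` norm `‖A‖_{1,2}`: the sum of the Euclidean norms of the rows of `A`. -/
noncomputable def norm12 (A : Matrix ι κ ℝ) : ℝ :=
  ∑ i, Real.sqrt (∑ j, A i j ^ 2)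

/-- The four Penrose equations: `P` is a Moore-Penrose inverse of the real matrix `A`. -/
structure IsMoorePenrose (A : Matrix ι κ ℝ) (P : Matrix κ ι ℝ) : Prop where
  mul_mul_self : A * P * A = A
  self_mul_mul : P * A * P = P
  symm_left : (A * P)ᵀ = A * P
  symm_right : (P * A)ᵀ = P * A

theorem IsMoorePenrose.unique {A : Matrix ι κ ℝ} {P Q : Matrix κ ι ℝ}
    (hP : IsMoorePenrose A P) (hQ : IsMoorePenrose A Q) : P = Q := by
  have h1 : A * P = A * Q := by
    calc A * P = (A * P)ᵀ := hP.symm_left.symm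
      _ = (A * Q * A * P)ᵀ := by rw [hQ.mul_mul_self]
      _ = ((A * Q) * (A * P))ᵀ := by simp only [Matrix.mul_assoc]
      _ = (A * P) * (A * Q) := by rw [transpose_mul, hP.symm_left, hQ.symm_left]
      _ = A * P * A * Q := by simp only [Matrix.mul_assoc]
      _ = A * Q := by rw [hP.mul_mul_self]
  have h2 : P * A = Q * A := by
    calc P * A = (P * A)ᵀ := hP.symm_right.symm
      _ = (P * (A * Q * A))ᵀ := by rw [hQ.mul_mul_self]
      _ = ((P * A) * (Q * A))ᵀ := by simp only [Matrix.mul_assoc]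
      _ = (Q * A) * (P * A) := by rw [transpose_mul, hP.symm_right, hQ.symm_right]
      _ = Q * (A * P * A) := by simp only [Matrix.mul_assoc]
      _ = Q * A := by rw [hP.mul_mul_self]
  calc P = P * A * P := hP.self_mul_mul.symm
    _ = Q * (A * P) := by rw [h2, Matrix.mul_assoc]
    _ = Q * A * Q := by rw [h1, Matrix.mul_assoc]
    _ = Q := hQ.self_mul_mul

theorem exists_isMoorePenrose (A : Matrix ι κ ℝ) : ∃ P, IsMoorePenrose A P := by
  classical
  have hS : (Aᵀ * A).IsHermitian := by
    simp [Matrix.IsHermitian, conjTranspose_eq_transpose_of_trivial]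
  obtain ⟨U, d, hU, hSd⟩ : ∃ (U : Matrix κ κ ℝ) (d : κ → ℝ), Uᵀ * U = 1 ∧
      Aᵀ * A = U * diagonal d * Uᵀ := by
    refine ⟨hS.eigenvectorUnitary, hS.eigenvalues, ?_, ?_⟩
    · have := Unitary.coe_star_mul_self hS.eigenvectorUnitary
      simpa [star_eq_conjTranspose, conjTranspose_eq_transpose_of_trivial] using this
    · have := hS.spectral_theorem
      simpa [Unitary.conjStarAlgAut_apply, star_eq_conjTranspose,
        conjTranspose_eq_transpose_of_trivial, Function.comp_def] using this
  set G : Matrix κ κ ℝ := U * diagonal (fun i => (d i)⁻¹) * Uᵀ with hG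
  have key : ∀ X Y : Matrix κ κ ℝ, (U * X * Uᵀ) * (U * Y * Uᵀ) = U * (X * Y) * Uᵀ := by
    intro X Y
    calc (U * X * Uᵀ) * (U * Y * Uᵀ) = U * X * (Uᵀ * U) * Y * Uᵀ := by
          simp only [Matrix.mul_assoc]
      _ = U * (X * Y) * Uᵀ := by rw [hU]; simp only [Matrix.mul_assoc, Matrix.one_mul]
  have hGt : Gᵀ = G := by
    simp [hG, transpose_mul, Matrix.mul_assoc]
  have hcomm : G * (Aᵀ * A) = (Aᵀ * A) * G := by
    rw [hSd, hG, key, key]; simp [mul_comm]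
  have hSGS : (Aᵀ * A) * G * (Aᵀ * A) = Aᵀ * A := by
    rw [hSd, hG, key, key]; simp
  have hGSG : G * (Aᵀ * A) * G = G := by
    have hd : ∀ i, (d i)⁻¹ * d i * (d i)⁻¹ = (d i)⁻¹ := fun i => by
      by_cases h : d i = 0 <;> simp [h]
    rw [hSd, hG, key, key]; simp [hd]
  refine ⟨G * Aᵀ, ?_, ?_, ?_, ?_⟩
  · have h0 : Aᴴ * A * (G * (Aᵀ * A) - 1) = 0 := by
      rw [conjTranspose_eq_transpose_of_trivial, Matrix.mul_sub, ← Matrix.mul_assoc, hSGS,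
        Matrix.mul_one, sub_self]
    have h1 := (conjTranspose_mul_self_mul_eq_zero A _).1 h0
    rw [Matrix.mul_sub, Matrix.mul_one, sub_eq_zero] at h1
    simpa only [Matrix.mul_assoc] using h1
  · calc G * Aᵀ * A * (G * Aᵀ) = (G * (Aᵀ * A) * G) * Aᵀ := by simp only [Matrix.mul_assoc]
      _ = G * Aᵀ := by rw [hGSG]
  · simp [transpose_mul, hGt, Matrix.mul_assoc]
  · calc (G * Aᵀ * A)ᵀ = (Aᵀ * A) * G := by simp [transpose_mul, hGt, Matrix.mul_assoc]
      _ = G * Aᵀ * A := by rw [← hcomm, ← Matrix.mul_assoc]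

/-- The Moore-Penrose inverse `A⁺` of a real matrix. -/
noncomputable def pinv (A : Matrix ι κ ℝ) : Matrix κ ι ℝ :=
  (exists_isMoorePenrose A).choose

theorem pinv_spec (A : Matrix ι κ ℝ) : IsMoorePenrose A (pinv A) :=
  (exists_isMoorePenrose A).choose_spec

end MatrixNotions

/-! ### The population -/

section Population

variable {p L : ℕ}

/-- The feature-label pairs `(x, ℓ)`. The label `ℓ` stands for the canonical basis vector
`e_ℓ` of `ℝ^L`. -/
abbrev Obs (p L : ℕ) : Type := EuclideanSpace ℝ (Fin p) × Fin L

/-- The `k`-th coordinate of the canonical basis vector `e_ℓ`. -/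
def oneHot (ℓ k : Fin L) : ℝ := if ℓ = k then 1 else 0

/-- The class probability `π_ℓ = ℙ(Y = e_ℓ)` under the law `P` of `(X, Y)`. -/
noncomputable def classProb (P : Measure (Obs p L)) (ℓ : Fin L) : ℝ :=
  P.real {z | z.2 = ℓ}

/-- `P` is the law of a pair `(X, Y)` from the Gaussian LDA model: every class has positive
probability, `X | Y = e_ℓ ∼ N(μ_ℓ, Σ_W)` with `μ_ℓ` the `ℓ`-th column of `M`, the within-class
covariance matrix `Σ_W` is positive definite, and `𝔼 X = 0`. -/
structure IsLDAModel (P : Measure (Obs p L)) (M : Matrix (Fin p) (Fin L) ℝ)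
    (SW : Matrix (Fin p) (Fin p) ℝ) : Prop where
  isProbabilityMeasure : IsProbabilityMeasure P
  posDef : SW.PosDef
  classProb_pos : ∀ ℓ, 0 < classProb P ℓ
  gaussian : ∀ ℓ : Fin L,
    HasLaw Prod.fst (multivariateGaussian (WithLp.toLp 2 (fun j => M j ℓ)) SW)
      (ProbabilityTheory.cond P {z | z.2 = ℓ})
  mean_zero : ∀ j : Fin p, ∫ z, z.1 j ∂P = 0

/-- `Σ = Cov(X)`. -/
noncomputable def covX (P : Measure (Obs p L)) : Matrix (Fin p) (Fin p) ℝ :=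
  Matrix.of fun i j => covariance (fun z : Obs p L => z.1 i) (fun z => z.1 j) P

/-- `Cov(X, Y)`. -/
noncomputable def covXY (P : Measure (Obs p L)) : Matrix (Fin p) (Fin L) ℝ :=
  Matrix.of fun i ℓ => covariance (fun z : Obs p L => z.1 i) (fun z => oneHot z.2 ℓ) P

/-- The regression matrix `B = Cov(X)⁻¹ Cov(X, Y)`. -/
noncomputable def regB (P : Measure (Obs p L)) : Matrix (Fin p) (Fin L) ℝ :=
  (covX P)⁻¹ * covXY P

/-- The discriminant directional matrix `B* = Σ_W⁻¹ M`. -/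
noncomputable def discB (SW : Matrix (Fin p) (Fin p) ℝ) (M : Matrix (Fin p) (Fin L) ℝ) :
    Matrix (Fin p) (Fin L) ℝ :=
  SW⁻¹ * M

/-- The squared Mahalanobis distance `(μ_k - μ_ℓ)ᵀ Σ_W⁻¹ (μ_k - μ_ℓ)`. -/
noncomputable def mahal (SW : Matrix (Fin p) (Fin p) ℝ) (M : Matrix (Fin p) (Fin L) ℝ)
    (k ℓ : Fin L) : ℝ :=
  (fun j => M j k - M j ℓ) ⬝ᵥ (SW⁻¹ *ᵥ (fun j => M j k - M j ℓ))

end Population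

/-! ### The sample and the estimators -/

section Sample

variable {n p L : ℕ}

/-- The feature matrix `𝐗`, with rows `X_i`. -/
def featMat (D : Fin n → Obs p L) : Matrix (Fin n) (Fin p) ℝ :=
  Matrix.of fun i j => (D i).1 j

/-- The response matrix `𝐘`, with rows `Y_i`. -/
def respMat (D : Fin n → Obs p L) : Matrix (Fin n) (Fin L) ℝ :=
  Matrix.of fun i ℓ => oneHot (D i).2 ℓ

/-- `M̂ = 𝐗ᵀ 𝐘 (𝐘ᵀ 𝐘)⁻¹`. -/
noncomputable def meanEst (D : Fin n → Obs p L) : Matrix (Fin p) (Fin L) ℝ :=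
  (featMat D)ᵀ * respMat D * ((respMat D)ᵀ * respMat D)⁻¹

/-- The plug-in matrix `Ĥ = n⁻¹ (𝐘ᵀ 𝐘 - B̂ᵀ 𝐗ᵀ 𝐗 B̂)`. -/
noncomputable def plugH (D : Fin n → Obs p L) (Bhat : Matrix (Fin p) (Fin L) ℝ) :
    Matrix (Fin L) (Fin L) ℝ :=
  (1 / (n : ℝ)) • ((respMat D)ᵀ * respMat D - Bhatᵀ * (featMat D)ᵀ * featMat D * Bhat)

/-- `B̂* = B̂ Ĥ⁺`. -/
noncomputable def discEst (D : Fin n → Obs p L) (Bhat : Matrix (Fin p) (Fin L) ℝ) :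
    Matrix (Fin p) (Fin L) ℝ :=
  Bhat * pinv (plugH D Bhat)

/-- The error measure `𝒬(A)` of an estimate `A` of `B*`:
`‖Σ_W^{1/2} (A - B*)‖_F² (Δ + log n) + ∑_ℓ [(μ̂_ℓ - μ_ℓ)ᵀ (A_ℓ - B*_ℓ)]²`. -/
noncomputable def errQ (SW : Matrix (Fin p) (Fin p) ℝ) (M : Matrix (Fin p) (Fin L) ℝ) (Δ : ℝ)
    (D : Fin n → Obs p L) (A : Matrix (Fin p) (Fin L) ℝ) : ℝ :=
  frobNorm (CFC.sqrt SW * (A - discB SW M)) ^ 2 * (Δ + Real.log n) +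
    ∑ ℓ : Fin L, (∑ j : Fin p, (meanEst D j ℓ - M j ℓ) * (A j ℓ - discB SW M j ℓ)) ^ 2

/-- The error bounds required of `B̂`: the in-sample prediction error and the `Σ_W`-weighted
Frobenius error are at most `ω₂`, and the `ℓ₁/ℓ₂` error is at most `ω₁`. -/
def ErrorBounds (P : Measure (Obs p L)) (SW : Matrix (Fin p) (Fin p) ℝ) (ω₁ ω₂ : ℝ)
    (D : Fin n → Obs p L) (Bhat : Matrix (Fin p) (Fin L) ℝ) : Prop :=
  max (1 / Real.sqrt n * frobNorm (featMat D * (Bhat - regB P)))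
      (frobNorm (CFC.sqrt SW * (Bhat - regB P))) ≤ ω₂ ∧
    norm12 (Bhat - regB P) ≤ ω₁

end Sample

end LDARegression

open LDARegression

/-!
Conditioning on the class gives `B = B* H` with `H⁻¹ = diag(π)⁻¹ + Mᵀ Σ_W⁻¹ M`, and
`H = diag(π) - Bᵀ Cov(X) B`. The matrix `Ĥ` is a small perturbation of `H`: it replaces `π` by the
class frequencies, the second moments of the discriminant scores `B*ᵀ X` by their sample versions,
and `B` by `B̂`. The first two perturbations are of relative order `√(L log n / n)` by Bernstein's
inequality and the third one of relative order `ω₂ √L`, so that `Ĥ` is invertible by a Neumann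
series argument and `‖Ĥ⁻¹‖ = O(L)`.

With `E = B̂ - B`, the error is `B̂ Ĥ⁻¹ - B* = E Ĥ⁻¹ - B* (Ĥ - H) Ĥ⁻¹`. The first term of `𝒬` is
bounded through the Frobenius norm of both parts. In the second term, `E Ĥ⁻¹` is paired with
`μ̂ - μ` through `‖E‖_{1,2}` and the maximum norm of `μ̂ - μ`, of order `√(L log (n ∨ p) / n)`,
whereas `B* (Ĥ - H) Ĥ⁻¹` only meets `μ̂ - μ` along the discriminant directions, where it is free
of `p`. Given the labels, `μ̂_ℓ - μ_ℓ` is Gaussian with a random number of summands, whence a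
self-normalised tail bound for it.
-/

namespace LDARegression

/-! ### Matrix norms -/

section MatrixNorms

open scoped Matrix.Norms.L2Operator

variable {ι κ τ : Type*} [Fintype ι] [Fintype κ] [Fintype τ]

theorem frobNorm_eq_norm (A : Matrix ι κ ℝ) :
    frobNorm A = ‖WithLp.toLp 2 (fun q : ι × κ => A q.1 q.2)‖ := by
  rw [EuclideanSpace.norm_eq, frobNorm, Fintype.sum_prod_type]
  simp

theorem frobNorm_nonneg (A : Matrix ι κ ℝ) : 0 ≤ frobNorm A := Real.sqrt_nonneg _

theorem frobNorm_sq (A : Matrix ι κ ℝ) : frobNorm A ^ 2 = ∑ i, ∑ j, A i j ^ 2 :=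
  Real.sq_sqrt (by positivity)

theorem frobNorm_add_le (A B : Matrix ι κ ℝ) : frobNorm (A + B) ≤ frobNorm A + frobNorm B := by
  simp only [frobNorm_eq_norm]
  exact norm_add_le (WithLp.toLp 2 fun q : ι × κ => A q.1 q.2) (WithLp.toLp 2 fun q => B q.1 q.2)

theorem frobNorm_sub_le (A B : Matrix ι κ ℝ) : frobNorm (A - B) ≤ frobNorm A + frobNorm B := by
  simp only [frobNorm_eq_norm]
  exact norm_sub_le (WithLp.toLp 2 fun q : ι × κ => A q.1 q.2) (WithLp.toLp 2 fun q => B q.1 q.2)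

theorem frobNorm_smul (a : ℝ) (A : Matrix ι κ ℝ) : frobNorm (a • A) = |a| * frobNorm A := by
  simp [frobNorm, mul_pow, ← Finset.mul_sum, Real.sqrt_mul (sq_nonneg a), Real.sqrt_sq_eq_abs]

theorem frobNorm_transpose (A : Matrix ι κ ℝ) : frobNorm Aᵀ = frobNorm A := by
  rw [frobNorm, Finset.sum_comm]
  rfl

theorem frobNorm_sq_eq_trace (A : Matrix ι κ ℝ) : frobNorm A ^ 2 = trace (Aᵀ * A) := by
  rw [frobNorm_sq, Finset.sum_comm]
  simp [trace, Matrix.mul_apply, sq]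

theorem frobNorm_le_of_abs_le (A : Matrix ι κ ℝ) {a : ℝ} (ha : 0 ≤ a) (h : ∀ i j, |A i j| ≤ a) :
    frobNorm A ≤ a * √(Fintype.card ι * Fintype.card κ) := by
  refine le_of_sq_le_sq ?_ (by positivity)
  rw [mul_pow, Real.sq_sqrt (by positivity), frobNorm_sq]
  calc ∑ i, ∑ j, A i j ^ 2 ≤ ∑ _i : ι, ∑ _j : κ, a ^ 2 :=
        Finset.sum_le_sum fun i _ => Finset.sum_le_sum fun j _ =>
          sq_le_sq' (abs_le.1 (h i j)).1 (abs_le.1 (h i j)).2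
    _ = a ^ 2 * (Fintype.card ι * Fintype.card κ) := by simp; ring

theorem norm12_nonneg (A : Matrix ι κ ℝ) : 0 ≤ norm12 A :=
  Finset.sum_nonneg fun _ _ => Real.sqrt_nonneg _

theorem sum_sq_sum_abs_le_norm12_sq (A : Matrix ι κ ℝ) :
    ∑ j, (∑ i, |A i j|) ^ 2 ≤ norm12 A ^ 2 := by
  have minkowski : ‖∑ i, (WithLp.toLp 2 (fun j => |A i j|) : EuclideanSpace ℝ κ)‖ ≤ norm12 A := by
    refine (norm_sum_le _ _).trans_eq (Finset.sum_congr rfl fun i _ => ?_)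
    simp [EuclideanSpace.norm_eq]
  refine le_trans (le_of_eq ?_) (pow_le_pow_left₀ (norm_nonneg _) minkowski 2)
  simp [EuclideanSpace.norm_sq_eq]

theorem sum_sq_sum_abs_le_card_mul_frobNorm_sq (A : Matrix ι κ ℝ) :
    ∑ j, (∑ i, |A i j|) ^ 2 ≤ Fintype.card ι * frobNorm A ^ 2 := by
  rw [frobNorm_sq, Finset.sum_comm, Finset.mul_sum]
  refine Finset.sum_le_sum fun j _ => ?_
  simpa using sq_sum_le_card_mul_sum_sq (s := Finset.univ) (f := fun i => |A i j|)

theorem sum_sq_sum_mul_le (A B : Matrix ι κ ℝ) {a : ℝ} (h : ∀ i j, |A i j| ≤ a) :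
    ∑ j, (∑ i, A i j * B i j) ^ 2 ≤ a ^ 2 * ∑ j, (∑ i, |B i j|) ^ 2 := by
  rw [Finset.mul_sum]
  refine Finset.sum_le_sum fun j _ => ?_
  rw [← mul_pow, ← sq_abs, Finset.mul_sum]
  refine pow_le_pow_left₀ (abs_nonneg _) ((Finset.abs_sum_le_sum_abs _ _).trans
    (Finset.sum_le_sum fun i _ => ?_)) 2
  rw [abs_mul]
  exact mul_le_mul_of_nonneg_right (h i j) (abs_nonneg _)

section

variable [DecidableEq κ]

theorem sum_mulVec_sq_le (A : Matrix ι κ ℝ) (v : κ → ℝ) :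
    ∑ i, (A *ᵥ v) i ^ 2 ≤ ‖A‖ ^ 2 * ∑ j, v j ^ 2 := by
  have h := pow_le_pow_left₀ (norm_nonneg _) (l2_opNorm_mulVec A (WithLp.toLp 2 v)) 2
  rw [mul_pow, EuclideanSpace.norm_sq_eq, EuclideanSpace.norm_sq_eq] at h
  simpa using h

theorem l2_opNorm_le_of_sum_mulVec_sq_le (A : Matrix ι κ ℝ) {a : ℝ} (ha : 0 ≤ a)
    (h : ∀ v : κ → ℝ, ∑ i, (A *ᵥ v) i ^ 2 ≤ a ^ 2 * ∑ j, v j ^ 2) : ‖A‖ ≤ a := by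
  rw [l2_opNorm_def]
  refine ContinuousLinearMap.opNorm_le_bound _ ha fun v => ?_
  refine le_of_sq_le_sq ?_ (by positivity)
  rw [mul_pow, EuclideanSpace.norm_sq_eq, EuclideanSpace.norm_sq_eq]
  simpa using h v.ofLp

theorem l2_opNorm_le_frobNorm (A : Matrix ι κ ℝ) : ‖A‖ ≤ frobNorm A := by
  refine l2_opNorm_le_of_sum_mulVec_sq_le A (frobNorm_nonneg A) fun v => ?_
  rw [frobNorm_sq, Finset.sum_mul]
  exact Finset.sum_le_sum fun i _ => Finset.sum_mul_sq_le_sq_mul_sq _ _ _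

theorem l2_opNorm_transpose [DecidableEq ι] (A : Matrix ι κ ℝ) : ‖Aᵀ‖ = ‖A‖ := by
  rw [← l2_opNorm_conjTranspose A, conjTranspose_eq_transpose_of_trivial]

theorem l2_opNorm_transpose_mul_self (A : Matrix ι κ ℝ) : ‖Aᵀ * A‖ = ‖A‖ ^ 2 := by
  rw [sq, ← l2_opNorm_conjTranspose_mul_self A, conjTranspose_eq_transpose_of_trivial]

theorem l2_opNorm_diagonal_le (d : κ → ℝ) {a : ℝ} (ha : 0 ≤ a) (h : ∀ i, |d i| ≤ a) :
    ‖(diagonal d : Matrix κ κ ℝ)‖ ≤ a := by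
  rw [l2_opNorm_diagonal]
  exact (pi_norm_le_iff_of_nonneg ha).2 h

theorem frobNorm_mul_le_l2_opNorm_mul_frobNorm (A : Matrix ι κ ℝ) (B : Matrix κ τ ℝ) :
    frobNorm (A * B) ≤ ‖A‖ * frobNorm B := by
  refine le_of_sq_le_sq ?_ (mul_nonneg (norm_nonneg _) (frobNorm_nonneg _))
  rw [mul_pow, ← frobNorm_transpose B, frobNorm_sq, frobNorm_sq, Finset.sum_comm, Finset.mul_sum]
  exact Finset.sum_le_sum fun j _ => sum_mulVec_sq_le A (fun i => B i j)

theorem isUnit_of_forall_mul_le_dotProduct_mulVec {J : Matrix κ κ ℝ} {b : ℝ} (hb : 0 < b)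
    (h : ∀ v : κ → ℝ, b * ∑ i, v i ^ 2 ≤ v ⬝ᵥ (J *ᵥ v)) : IsUnit J := by
  rw [isUnit_iff_isUnit_det, isUnit_iff_ne_zero]
  intro hdet
  obtain ⟨v, hv, hJv⟩ := exists_mulVec_eq_zero_iff.2 hdet
  have hsum : ∑ i, v i ^ 2 ≤ 0 := by
    have hbv := h v
    rw [hJv, dotProduct_zero] at hbv
    exact nonpos_of_mul_nonpos_right hbv hb
  refine hv (funext fun i => ?_)
  have hzero := (Finset.sum_eq_zero_iff_of_nonneg fun i _ => sq_nonneg (v i)).1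
    (hsum.antisymm (by positivity)) i (Finset.mem_univ i)
  simpa using hzero

theorem l2_opNorm_nonsing_inv_le {J : Matrix κ κ ℝ} {b : ℝ} (hb : 0 < b)
    (h : ∀ v : κ → ℝ, b * ∑ i, v i ^ 2 ≤ v ⬝ᵥ (J *ᵥ v)) : ‖J⁻¹‖ ≤ b⁻¹ := by
  have hJ := isUnit_of_forall_mul_le_dotProduct_mulVec hb h
  refine l2_opNorm_le_of_sum_mulVec_sq_le _ (by positivity) fun w => ?_
  set v := J⁻¹ *ᵥ w with hv
  have hw : J *ᵥ v = w := by
    rw [hv, mulVec_mulVec, mul_nonsing_inv _ ((isUnit_iff_isUnit_det _).1 hJ), one_mulVec]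
  have hsq : (b * ∑ i, v i ^ 2) ^ 2 ≤ (∑ i, v i ^ 2) * ∑ i, w i ^ 2 := by
    refine (pow_le_pow_left₀ (by positivity) ((h v).trans_eq (by rw [hw])) 2).trans ?_
    exact Finset.sum_mul_sq_le_sq_mul_sq _ _ _
  rcases (show 0 ≤ ∑ i, v i ^ 2 by positivity).eq_or_lt with hzero | hpos
  · rw [← hzero]; positivity
  have hvw : b ^ 2 * ∑ i, v i ^ 2 ≤ ∑ i, w i ^ 2 :=
    le_of_mul_le_mul_left (by linarith) hpos
  rw [inv_pow, inv_mul_eq_div, le_div_iff₀ (by positivity)]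
  linarith

theorem isUnit_add_of_l2_opNorm_lt_one {H Z : Matrix κ κ ℝ} (hH : IsUnit H)
    (hZ : ‖H⁻¹ * Z‖ < 1) : IsUnit (H + Z) := by
  have hfactor : H + Z = H * (1 - -(H⁻¹ * Z)) := by
    rw [mul_sub, mul_neg, ← mul_assoc, mul_nonsing_inv _ ((isUnit_iff_isUnit_det _).1 hH)]
    simp
  rw [hfactor]
  exact hH.mul (isUnit_one_sub_of_norm_lt_one (by rwa [norm_neg]))

theorem l2_opNorm_nonsing_inv_add_le {H Z : Matrix κ κ ℝ} (hH : IsUnit H)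
    (hZ : ‖H⁻¹ * Z‖ < 1) : ‖(H + Z)⁻¹‖ ≤ ‖H⁻¹‖ / (1 - ‖H⁻¹ * Z‖) := by
  have hHZ := (isUnit_iff_isUnit_det _).1 (isUnit_add_of_l2_opNorm_lt_one hH hZ)
  have hresolvent : (H + Z)⁻¹ = H⁻¹ - H⁻¹ * Z * (H + Z)⁻¹ := by
    calc (H + Z)⁻¹ = H⁻¹ * (H + Z) * (H + Z)⁻¹ - H⁻¹ * Z * (H + Z)⁻¹ := by
          rw [← sub_mul, mul_add, nonsing_inv_mul _ ((isUnit_iff_isUnit_det _).1 hH),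
            add_sub_cancel_right, one_mul]
      _ = H⁻¹ - H⁻¹ * Z * (H + Z)⁻¹ := by rw [mul_assoc H⁻¹, mul_nonsing_inv _ hHZ, mul_one]
  have hnorm : ‖(H + Z)⁻¹‖ ≤ ‖H⁻¹‖ + ‖H⁻¹ * Z‖ * ‖(H + Z)⁻¹‖ := by
    conv_lhs => rw [hresolvent]
    exact (norm_sub_le _ _).trans (by gcongr; exact norm_mul_le _ _)
  rw [le_div_iff₀ (by linarith)]
  linarith

end

theorem frobNorm_mul_le_frobNorm_mul_l2_opNorm [DecidableEq τ] (A : Matrix ι κ ℝ)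
    (B : Matrix κ τ ℝ) : frobNorm (A * B) ≤ frobNorm A * ‖B‖ := by
  classical
  rw [← frobNorm_transpose, transpose_mul, mul_comm, ← l2_opNorm_transpose B,
    ← frobNorm_transpose A]
  exact frobNorm_mul_le_l2_opNorm_mul_frobNorm _ _

theorem norm12_mul_le [DecidableEq τ] (A : Matrix ι κ ℝ) (B : Matrix κ τ ℝ) :
    norm12 (A * B) ≤ norm12 A * ‖B‖ := by
  classical
  rw [norm12, norm12, Finset.sum_mul]
  refine Finset.sum_le_sum fun i _ => ?_
  rw [mul_comm, ← Real.sqrt_sq (norm_nonneg B), ← Real.sqrt_mul (sq_nonneg _)]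
  refine Real.sqrt_le_sqrt ?_
  calc ∑ j, (A * B) i j ^ 2 = ∑ j, (Bᵀ *ᵥ A i) j ^ 2 := by
        simp only [Matrix.mul_apply, mulVec, dotProduct, transpose_apply, mul_comm]
    _ ≤ ‖B‖ ^ 2 * ∑ j, A i j ^ 2 := by
        rw [← l2_opNorm_transpose B]
        exact sum_mulVec_sq_le Bᵀ (A i)

end MatrixNorms

/-! ### Perturbation of the residual matrix -/

section Perturbation

open scoped Matrix.Norms.L2Operator

variable {ν κ : Type*} [Fintype ν] [Fintype κ] [DecidableEq κ]

/-- The population residual matrix `H = (diag(d)⁻¹ + G)⁻¹` of the regression of the label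
indicators on the features, for the class weights `d` and the discriminant Gram matrix
`G = Mᵀ Σ_W⁻¹ M`. -/
noncomputable def residualCov (d : κ → ℝ) (G : Matrix κ κ ℝ) : Matrix κ κ ℝ :=
  (diagonal (fun ℓ => (d ℓ)⁻¹) + G)⁻¹

/-- The residual matrix `diag(d) - Zᵀ Z` of the label indicators after a regression with fitted
values `Z`, for the class weights `d`. -/
noncomputable def residualGram (d : κ → ℝ) (Z : Matrix ν κ ℝ) : Matrix κ κ ℝ :=
  diagonal d - Zᵀ * Z

/-- The deviation of the second moments of the scores `X` from their population value. -/
noncomputable def momentPerturbation (d : κ → ℝ) (G : Matrix κ κ ℝ) (X : Matrix ν κ ℝ) :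
    Matrix κ κ ℝ :=
  Xᵀ * X - G * diagonal d * (diagonal (fun ℓ => (d ℓ)⁻¹) + G)

/-- The deviation of the second moments of the fitted values `X H + R` from the population value
`diag(d) - H`, where `R` is the error of the fit. -/
noncomputable def fitPerturbation (d : κ → ℝ) (G : Matrix κ κ ℝ) (X R : Matrix ν κ ℝ) :
    Matrix κ κ ℝ :=
  (X * residualCov d G + R)ᵀ * (X * residualCov d G + R) - (diagonal d - residualCov d G)

theorem residualGram_eq (d d' : κ → ℝ) (G : Matrix κ κ ℝ) (X R : Matrix ν κ ℝ) :
    residualGram d' (X * residualCov d G + R) =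
      residualCov d G + (diagonal (d' - d) - fitPerturbation d G X R) := by
  have hd : diagonal (d' - d) = diagonal d' - diagonal d := (diagonal_sub d' d).symm
  rw [residualGram, fitPerturbation, hd]
  abel

/-- The deterministic setting of the plug-in step with `r ^ 2` classes: the class weights `d` and
the Gram matrix `G` are of constant order `K` (after rescaling), the empirical weights `d'` and the
second moments of the scores `X` are within `δ` of their population values, and the error `R` of
the fitted values `X H + R` is at most `ω`. -/
structure PerturbedRegression (K r δ ω : ℝ) (d d' : κ → ℝ) (G : Matrix κ κ ℝ)
    (X R : Matrix ν κ ℝ) : Prop where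
  one_le : 1 ≤ K
  card_eq : (Fintype.card κ : ℝ) = r ^ 2
  one_le_sqrt_card : 1 ≤ r
  delta_nonneg : 0 ≤ δ
  delta_le : 40 * K ^ 4 * δ ≤ 1
  omega_le : 40 * K ^ 4 * (ω * r) ≤ 1
  weight_pos : ∀ ℓ, 0 < d ℓ
  weight_inv_le : ∀ ℓ, (d ℓ)⁻¹ ≤ K * r ^ 2
  weight_le : ∀ ℓ, d ℓ ≤ K / r ^ 2
  posSemidef : G.PosSemidef
  gram_le : ∀ k ℓ, |G k ℓ| ≤ K
  weight_sub_le : ∀ ℓ, |d' ℓ - d ℓ| ≤ K * δ / r ^ 2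
  moment_le : ∀ k ℓ, |momentPerturbation d G X k ℓ| ≤ K * δ / r
  error_le : frobNorm R ≤ ω

namespace PerturbedRegression

variable {K r δ ω : ℝ} {d d' : κ → ℝ} {G : Matrix κ κ ℝ} {X R : Matrix ν κ ℝ}

theorem K_pos (h : PerturbedRegression K r δ ω d d' G X R) : 0 < K :=
  one_pos.trans_le h.one_le

theorem r_pos (h : PerturbedRegression K r δ ω d d' G X R) : 0 < r :=
  one_pos.trans_le h.one_le_sqrt_card

theorem omega_nonneg (h : PerturbedRegression K r δ ω d d' G X R) : 0 ≤ ω :=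
  (frobNorm_nonneg _).trans h.error_le

theorem div_sq_mul_sum_sq_le (h : PerturbedRegression K r δ ω d d' G X R) (v : κ → ℝ) :
    r ^ 2 / K * ∑ i, v i ^ 2 ≤ v ⬝ᵥ ((diagonal (fun ℓ => (d ℓ)⁻¹) + G) *ᵥ v) := by
  have hgram : 0 ≤ v ⬝ᵥ (G *ᵥ v) := by simpa using h.posSemidef.dotProduct_mulVec_nonneg v
  have hweight : r ^ 2 / K * ∑ i, v i ^ 2 ≤ v ⬝ᵥ (diagonal (fun ℓ => (d ℓ)⁻¹) *ᵥ v) := by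
    rw [Finset.mul_sum, dotProduct]
    refine Finset.sum_le_sum fun i _ => ?_
    calc r ^ 2 / K * v i ^ 2 ≤ (d i)⁻¹ * v i ^ 2 := by
          rw [← inv_div]
          exact mul_le_mul_of_nonneg_right (inv_anti₀ (h.weight_pos i) (h.weight_le i))
            (sq_nonneg _)
      _ = v i * (diagonal (fun ℓ => (d ℓ)⁻¹) *ᵥ v) i := by rw [mulVec_diagonal]; ring
  rw [add_mulVec, dotProduct_add]
  linarith

theorem isUnit_precision (h : PerturbedRegression K r δ ω d d' G X R) :
    IsUnit (diagonal (fun ℓ => (d ℓ)⁻¹) + G) :=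
  isUnit_of_forall_mul_le_dotProduct_mulVec (div_pos (pow_pos h.r_pos 2) h.K_pos)
    h.div_sq_mul_sum_sq_le

theorem precision_mul (h : PerturbedRegression K r δ ω d d' G X R) :
    (diagonal (fun ℓ => (d ℓ)⁻¹) + G) * residualCov d G = 1 :=
  mul_nonsing_inv _ ((isUnit_iff_isUnit_det _).1 h.isUnit_precision)

theorem mul_precision (h : PerturbedRegression K r δ ω d d' G X R) :
    residualCov d G * (diagonal (fun ℓ => (d ℓ)⁻¹) + G) = 1 :=
  mul_eq_one_comm.1 h.precision_mul

theorem isUnit_residualCov (h : PerturbedRegression K r δ ω d d' G X R) :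
    IsUnit (residualCov d G) :=
  ⟨⟨_, _, h.mul_precision, h.precision_mul⟩, rfl⟩

theorem residualCov_inv (h : PerturbedRegression K r δ ω d d' G X R) :
    (residualCov d G)⁻¹ = diagonal (fun ℓ => (d ℓ)⁻¹) + G :=
  inv_eq_left_inv h.precision_mul

theorem residualCov_transpose (h : PerturbedRegression K r δ ω d d' G X R) :
    (residualCov d G)ᵀ = residualCov d G := by
  have hG : Gᵀ = G := by
    rw [← conjTranspose_eq_transpose_of_trivial]
    exact h.posSemidef.isHermitian
  rw [residualCov, transpose_nonsing_inv, transpose_add, diagonal_transpose, hG]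

theorem norm_precision_le (h : PerturbedRegression K r δ ω d d' G X R) :
    ‖diagonal (fun ℓ => (d ℓ)⁻¹) + G‖ ≤ 2 * K * r ^ 2 := by
  have hK := h.K_pos
  have hweight : ‖(diagonal (fun ℓ => (d ℓ)⁻¹) : Matrix κ κ ℝ)‖ ≤ K * r ^ 2 :=
    l2_opNorm_diagonal_le _ (by positivity) fun ℓ => by
      rw [abs_of_pos (inv_pos.2 (h.weight_pos ℓ))]; exact h.weight_inv_le ℓ
  have hgram : ‖G‖ ≤ K * r ^ 2 := by
    refine (l2_opNorm_le_frobNorm G).trans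
      ((frobNorm_le_of_abs_le G hK.le h.gram_le).trans_eq ?_)
    rw [h.card_eq, Real.sqrt_mul_self (by positivity)]
  linarith [norm_add_le (diagonal (fun ℓ => (d ℓ)⁻¹) : Matrix κ κ ℝ) G]

theorem norm_residualCov_le (h : PerturbedRegression K r δ ω d d' G X R) :
    ‖residualCov d G‖ ≤ K / r ^ 2 := by
  rw [← inv_div]
  exact l2_opNorm_nonsing_inv_le (div_pos (pow_pos h.r_pos 2) h.K_pos) h.div_sq_mul_sum_sq_le

theorem frobNorm_momentPerturbation_sandwich_le
    (h : PerturbedRegression K r δ ω d d' G X R) :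
    frobNorm (residualCov d G * momentPerturbation d G X * residualCov d G) ≤
      K ^ 3 * δ / r ^ 3 := by
  have hK := h.K_pos
  have hr := h.r_pos
  have hδ := h.delta_nonneg
  have hmoment : frobNorm (momentPerturbation d G X) ≤ K * δ * r := by
    refine (frobNorm_le_of_abs_le _ (by positivity) h.moment_le).trans_eq ?_
    rw [h.card_eq, Real.sqrt_mul_self (by positivity)]
    field_simp
  calc frobNorm (residualCov d G * momentPerturbation d G X * residualCov d G)
      ≤ ‖residualCov d G‖ * frobNorm (momentPerturbation d G X) * ‖residualCov d G‖ :=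
        (frobNorm_mul_le_frobNorm_mul_l2_opNorm _ _).trans (mul_le_mul_of_nonneg_right
          (frobNorm_mul_le_l2_opNorm_mul_frobNorm _ _) (norm_nonneg _))
    _ ≤ K / r ^ 2 * (K * δ * r) * (K / r ^ 2) := by
        have := frobNorm_nonneg (momentPerturbation d G X)
        gcongr <;> exact h.norm_residualCov_le
    _ = K ^ 3 * δ / r ^ 3 := by field_simp

theorem residualCov_mul_gram_mul_diagonal (h : PerturbedRegression K r δ ω d d' G X R) :
    residualCov d G * G * diagonal d = diagonal d - residualCov d G := by
  have hd : diagonal (fun ℓ => (d ℓ)⁻¹) * diagonal d = 1 := by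
    rw [diagonal_mul_diagonal, ← diagonal_one]
    exact congrArg _ (funext fun ℓ => inv_mul_cancel₀ (h.weight_pos ℓ).ne')
  have hHG : residualCov d G * G = 1 - residualCov d G * diagonal (fun ℓ => (d ℓ)⁻¹) := by
    rw [eq_sub_iff_add_eq, add_comm, ← mul_add, h.mul_precision]
  rw [hHG, sub_mul, one_mul, Matrix.mul_assoc, hd, mul_one]

theorem fit_transpose_mul_self (h : PerturbedRegression K r δ ω d d' G X R) :
    (X * residualCov d G)ᵀ * (X * residualCov d G) = diagonal d - residualCov d G +
      residualCov d G * momentPerturbation d G X * residualCov d G := by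
  have hHt := h.residualCov_transpose
  set H := residualCov d G
  calc (X * H)ᵀ * (X * H) = H * (Xᵀ * X) * H := by
        rw [transpose_mul, hHt]
        simp only [Matrix.mul_assoc]
    _ = H * (G * diagonal d * (diagonal (fun ℓ => (d ℓ)⁻¹) + G) +
          momentPerturbation d G X) * H := by
        rw [momentPerturbation, add_sub_cancel]
    _ = H * G * diagonal d * ((diagonal (fun ℓ => (d ℓ)⁻¹) + G) * H) +
          H * momentPerturbation d G X * H := by
        simp only [mul_add, add_mul, Matrix.mul_assoc]
    _ = diagonal d - H + H * momentPerturbation d G X * H := by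
        rw [h.precision_mul, mul_one, h.residualCov_mul_gram_mul_diagonal]

theorem fitPerturbation_eq (h : PerturbedRegression K r δ ω d d' G X R) :
    fitPerturbation d G X R = Rᵀ * R + Rᵀ * (X * residualCov d G) +
      (X * residualCov d G)ᵀ * R +
        residualCov d G * momentPerturbation d G X * residualCov d G := by
  rw [fitPerturbation, transpose_add, Matrix.mul_add, Matrix.add_mul, Matrix.add_mul,
    h.fit_transpose_mul_self]
  abel

theorem norm_fit_le (h : PerturbedRegression K r δ ω d d' G X R) :
    ‖X * residualCov d G‖ ≤ 2 * K / r := by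
  have hK := h.K_pos
  have hr := h.r_pos
  have hδ := h.delta_nonneg
  have hweight : ‖(diagonal d : Matrix κ κ ℝ)‖ ≤ K / r ^ 2 :=
    l2_opNorm_diagonal_le _ (by positivity) fun ℓ => by
      rw [abs_of_pos (h.weight_pos ℓ)]; exact h.weight_le ℓ
  have hmoment : ‖residualCov d G * momentPerturbation d G X * residualCov d G‖ ≤ K / r ^ 2 := by
    refine (l2_opNorm_le_frobNorm _).trans
      (h.frobNorm_momentPerturbation_sandwich_le.trans ?_)
    have hKδ : K ^ 3 * δ ≤ K ^ 4 * δ := by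
      gcongr
      exacts [h.one_le, by norm_num]
    exact div_le_div₀ hK.le (by linarith [h.delta_le, h.one_le]) (by positivity)
      (pow_le_pow_right₀ h.one_le_sqrt_card (by norm_num))
  refine le_of_sq_le_sq ?_ (by positivity)
  rw [← l2_opNorm_transpose_mul_self, h.fit_transpose_mul_self]
  calc _ ≤ ‖(diagonal d : Matrix κ κ ℝ)‖ + ‖residualCov d G‖ +
          ‖residualCov d G * momentPerturbation d G X * residualCov d G‖ :=
        (norm_add_le _ _).trans (add_le_add_left (norm_sub_le _ _) _)
    _ ≤ K / r ^ 2 + K / r ^ 2 + K / r ^ 2 := by gcongr; exact h.norm_residualCov_le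
    _ = 3 * K / r ^ 2 := by ring
    _ ≤ 4 * K ^ 2 / r ^ 2 := by gcongr ?_ / _; nlinarith [h.one_le]
    _ = (2 * K / r) ^ 2 := by ring

theorem frobNorm_fitPerturbation_le (h : PerturbedRegression K r δ ω d d' G X R) :
    frobNorm (fitPerturbation d G X R) ≤ K ^ 3 * (5 * (ω * r) + δ) / r ^ 2 := by
  have hK := h.K_pos
  have hr := h.r_pos
  have hω := h.omega_nonneg
  have hδ := h.delta_nonneg
  have hRt : frobNorm Rᵀ ≤ ω := by rw [frobNorm_transpose]; exact h.error_le
  have hsq : frobNorm (Rᵀ * R) ≤ ω * ω :=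
    (frobNorm_mul_le_frobNorm_mul_l2_opNorm _ _).trans
      (mul_le_mul hRt ((l2_opNorm_le_frobNorm _).trans h.error_le) (norm_nonneg _) hω)
  have hcross : frobNorm (Rᵀ * (X * residualCov d G)) ≤ ω * (2 * K / r) :=
    (frobNorm_mul_le_frobNorm_mul_l2_opNorm _ _).trans
      (mul_le_mul hRt h.norm_fit_le (norm_nonneg _) hω)
  have hcross' : frobNorm ((X * residualCov d G)ᵀ * R) ≤ ω * (2 * K / r) := by
    rwa [← frobNorm_transpose, transpose_mul, transpose_transpose]
  have hω_le : ω * r ≤ K := by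
    nlinarith [h.omega_le, h.one_le, one_le_pow₀ (n := 4) h.one_le, mul_nonneg hω hr.le]
  rw [h.fitPerturbation_eq]
  calc _ ≤ ω * ω + ω * (2 * K / r) + ω * (2 * K / r) + K ^ 3 * δ / r ^ 3 := by
        refine (frobNorm_add_le _ _).trans
          (add_le_add ?_ h.frobNorm_momentPerturbation_sandwich_le)
        refine (frobNorm_add_le _ _).trans (add_le_add ?_ hcross')
        exact (frobNorm_add_le _ _).trans (add_le_add hsq hcross)
    _ = (ω * r * (ω * r) + 4 * K * (ω * r)) / r ^ 2 + K ^ 3 * δ / r ^ 3 := by field_simp; ring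
    _ ≤ (K * (ω * r) + 4 * K * (ω * r)) / r ^ 2 + K ^ 3 * δ / r ^ 2 := by
        gcongr
        exacts [h.one_le_sqrt_card, by norm_num]
    _ = (K * (5 * (ω * r)) + K ^ 3 * δ) / r ^ 2 := by ring
    _ ≤ (K ^ 3 * (5 * (ω * r)) + K ^ 3 * δ) / r ^ 2 := by
        gcongr
        exact le_self_pow₀ h.one_le (by norm_num)
    _ = K ^ 3 * (5 * (ω * r) + δ) / r ^ 2 := by ring

theorem norm_weight_sub_le (h : PerturbedRegression K r δ ω d d' G X R) :
    ‖(diagonal (d' - d) : Matrix κ κ ℝ)‖ ≤ K * δ / r ^ 2 := by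
  have hK := h.K_pos
  have hδ := h.delta_nonneg
  exact l2_opNorm_diagonal_le _ (by positivity) h.weight_sub_le

theorem norm_perturbation_le (h : PerturbedRegression K r δ ω d d' G X R) :
    ‖diagonal (d' - d) - fitPerturbation d G X R‖ ≤ 5 * K ^ 3 * (ω * r + δ) / r ^ 2 := by
  have hδ := h.delta_nonneg
  have hδK : K * δ ≤ K ^ 3 * δ := by
    gcongr
    exact le_self_pow₀ h.one_le (by norm_num)
  have hδ3 : 0 ≤ K ^ 3 * δ := mul_nonneg (pow_nonneg h.K_pos.le 3) hδ
  calc _ ≤ K * δ / r ^ 2 + K ^ 3 * (5 * (ω * r) + δ) / r ^ 2 :=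
        (norm_sub_le _ _).trans (add_le_add h.norm_weight_sub_le
          ((l2_opNorm_le_frobNorm _).trans h.frobNorm_fitPerturbation_le))
    _ = (K * δ + K ^ 3 * (5 * (ω * r) + δ)) / r ^ 2 := by ring
    _ ≤ 5 * K ^ 3 * (ω * r + δ) / r ^ 2 := by
        gcongr ?_ / _
        linarith

theorem norm_inv_mul_perturbation_le (h : PerturbedRegression K r δ ω d d' G X R) :
    ‖(residualCov d G)⁻¹ * (diagonal (d' - d) - fitPerturbation d G X R)‖ ≤ 1 / 2 := by
  have hK := h.K_pos
  have hr := h.r_pos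
  rw [h.residualCov_inv]
  calc _ ≤ 2 * K * r ^ 2 * (5 * K ^ 3 * (ω * r + δ) / r ^ 2) :=
        (norm_mul_le _ _).trans
          (mul_le_mul h.norm_precision_le h.norm_perturbation_le (norm_nonneg _) (by positivity))
    _ = (40 * K ^ 4 * (ω * r) + 40 * K ^ 4 * δ) / 4 := by field_simp; ring
    _ ≤ 1 / 2 := by linarith [h.omega_le, h.delta_le]

theorem isUnit_residualGram (h : PerturbedRegression K r δ ω d d' G X R) :
    IsUnit (residualGram d' (X * residualCov d G + R)) := by
  rw [residualGram_eq d]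
  exact isUnit_add_of_l2_opNorm_lt_one h.isUnit_residualCov
    (h.norm_inv_mul_perturbation_le.trans_lt (by norm_num))

theorem norm_residualGram_inv_le (h : PerturbedRegression K r δ ω d d' G X R) :
    ‖(residualGram d' (X * residualCov d G + R))⁻¹‖ ≤ 4 * K * r ^ 2 := by
  have hsmall := h.norm_inv_mul_perturbation_le
  have hinv := h.norm_precision_le
  rw [residualGram_eq d]
  refine (l2_opNorm_nonsing_inv_add_le h.isUnit_residualCov (by linarith)).trans ?_
  rw [h.residualCov_inv] at hsmall ⊢
  rw [div_le_iff₀ (by linarith)]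
  have hscale : 0 ≤ 4 * K * r ^ 2 := by have := h.K_pos; positivity
  linarith [mul_le_mul_of_nonneg_left hsmall hscale]

end PerturbedRegression

end Perturbation

section PluginError

open scoped Matrix.Norms.L2Operator

variable {ν ι κ : Type*} [Fintype ν] [Fintype κ] [DecidableEq κ]

namespace PerturbedRegression

variable {K r δ ω : ℝ} {d d' : κ → ℝ} {G : Matrix κ κ ℝ} {X R : Matrix ν κ ℝ}

theorem perturbation_mul_inv (h : PerturbedRegression K r δ ω d d' G X R) :
    (diagonal (d' - d) - fitPerturbation d G X R) *
        (residualGram d' (X * residualCov d G + R))⁻¹ =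
      1 - residualCov d G * (residualGram d' (X * residualCov d G + R))⁻¹ := by
  have hT := mul_nonsing_inv _ ((isUnit_iff_isUnit_det _).1 h.isUnit_residualGram)
  rw [eq_sub_iff_add_eq, ← hT, ← add_mul, residualGram_eq d, add_comm]

theorem plugin_error_eq (h : PerturbedRegression K r δ ω d d' G X R) (β E : Matrix ι κ ℝ) :
    (β * residualCov d G + E) * (residualGram d' (X * residualCov d G + R))⁻¹ - β =
      E * (residualGram d' (X * residualCov d G + R))⁻¹ -
        β * ((diagonal (d' - d) - fitPerturbation d G X R) *
          (residualGram d' (X * residualCov d G + R))⁻¹) := by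
  rw [h.perturbation_mul_inv, Matrix.mul_sub, Matrix.mul_one, Matrix.add_mul, Matrix.mul_assoc]
  abel

theorem frobNorm_plugin_error_le [Fintype ι] (h : PerturbedRegression K r δ ω d d' G X R)
    {β E : Matrix ι κ ℝ} (hβ : βᵀ * β = G) (hE : frobNorm E ≤ ω) :
    frobNorm ((β * residualCov d G + E) * (residualGram d' (X * residualCov d G + R))⁻¹ - β) ≤
      24 * K ^ 5 * r ^ 2 * (ω + δ / r) := by
  have hK := h.K_pos
  have hr := h.r_pos
  have hδ := h.delta_nonneg
  have hω := h.omega_nonneg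
  set Z := diagonal (d' - d) - fitPerturbation d G X R
  have hβ_le : frobNorm β ≤ K * r := by
    refine le_of_sq_le_sq ?_ (by positivity)
    calc frobNorm β ^ 2 = ∑ ℓ, G ℓ ℓ := by rw [frobNorm_sq_eq_trace, hβ]; rfl
      _ ≤ ∑ _ℓ : κ, K := Finset.sum_le_sum fun ℓ _ => (le_abs_self _).trans (h.gram_le ℓ ℓ)
      _ = K * r ^ 2 := by simp [h.card_eq, mul_comm]
      _ ≤ K ^ 2 * r ^ 2 := by gcongr; exact le_self_pow₀ h.one_le (by norm_num)
      _ = (K * r) ^ 2 := by ring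
  have hfactor : frobNorm (E - β * Z) ≤ 6 * K ^ 4 * (ω + δ / r) := by
    calc frobNorm (E - β * Z) ≤ ω + K * r * (5 * K ^ 3 * (ω * r + δ) / r ^ 2) :=
          (frobNorm_sub_le _ _).trans (add_le_add hE
            ((frobNorm_mul_le_frobNorm_mul_l2_opNorm _ _).trans
              (mul_le_mul hβ_le h.norm_perturbation_le (norm_nonneg _) (by positivity))))
      _ = ω + 5 * K ^ 4 * (ω + δ / r) := by field_simp
      _ ≤ K ^ 4 * (ω + δ / r) + 5 * K ^ 4 * (ω + δ / r) := by
          gcongr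
          have : 0 ≤ δ / r := by positivity
          nlinarith [one_le_pow₀ (n := 4) h.one_le]
      _ = 6 * K ^ 4 * (ω + δ / r) := by ring
  rw [h.plugin_error_eq, ← Matrix.mul_assoc, ← Matrix.sub_mul]
  calc _ ≤ 6 * K ^ 4 * (ω + δ / r) * (4 * K * r ^ 2) :=
        (frobNorm_mul_le_frobNorm_mul_l2_opNorm _ _).trans
          (mul_le_mul hfactor h.norm_residualGram_inv_le (norm_nonneg _) (by positivity))
    _ = 24 * K ^ 5 * r ^ 2 * (ω + δ / r) := by ring

theorem sum_abs_weight_sub_mul_precision_le (h : PerturbedRegression K r δ ω d d' G X R)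
    (V : Matrix κ κ ℝ) (ℓ : κ) :
    ∑ k, |(diagonal (d' - d) * ((diagonal (fun i => (d i)⁻¹) + G) * V)) k ℓ| ≤
      2 * K ^ 2 * δ * ∑ k, |V k ℓ| := by
  have hK := h.K_pos
  have hr := h.r_pos
  have hδ := h.delta_nonneg
  have hprecision : ∀ k, |((diagonal (fun i => (d i)⁻¹) + G) * V) k ℓ| ≤
      K * r ^ 2 * |V k ℓ| + K * ∑ j, |V j ℓ| := by
    intro k
    rw [Matrix.add_mul, Matrix.add_apply, diagonal_mul, Matrix.mul_apply, Finset.mul_sum]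
    refine (abs_add_le _ _).trans (add_le_add ?_ ((Finset.abs_sum_le_sum_abs _ _).trans
      (Finset.sum_le_sum fun j _ => ?_)))
    · rw [abs_mul, abs_of_pos (inv_pos.2 (h.weight_pos k))]
      exact mul_le_mul_of_nonneg_right (h.weight_inv_le k) (abs_nonneg _)
    · rw [abs_mul]
      exact mul_le_mul_of_nonneg_right (h.gram_le k j) (abs_nonneg _)
  calc _ ≤ ∑ k, K * δ / r ^ 2 * (K * r ^ 2 * |V k ℓ| + K * ∑ j, |V j ℓ|) := by
        refine Finset.sum_le_sum fun k _ => ?_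
        rw [diagonal_mul, abs_mul]
        exact mul_le_mul (h.weight_sub_le k) (hprecision k) (abs_nonneg _) (by positivity)
    _ = K * δ / r ^ 2 * (K * r ^ 2 * ∑ k, |V k ℓ| + r ^ 2 * (K * ∑ j, |V j ℓ|)) := by
        rw [← Finset.mul_sum, Finset.sum_add_distrib, ← Finset.mul_sum, Finset.sum_const]
        simp [h.card_eq]
    _ = 2 * K ^ 2 * δ * ∑ k, |V k ℓ| := by field_simp; ring

-- Since `H T = 1 - Z T`, the `ℓ₁` norm of a column of `H T` is in turn bounded by the left-hand
-- side, and the factor `2 K² δ` is at most `1 / 2`, so the inequality can be solved.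
theorem sum_abs_weight_sub_mul_inv_le (h : PerturbedRegression K r δ ω d d' G X R) (ℓ : κ) :
    ∑ k, |(diagonal (d' - d) * (residualGram d' (X * residualCov d G + R))⁻¹) k ℓ| ≤
      1 + ∑ k, |(fitPerturbation d G X R *
        (residualGram d' (X * residualCov d G + R))⁻¹) k ℓ| := by
  have hZT := h.perturbation_mul_inv
  set T := (residualGram d' (X * residualCov d G + R))⁻¹
  set V := residualCov d G * T with hV
  have hVT : (diagonal (fun i => (d i)⁻¹) + G) * V = T := by
    rw [hV, ← Matrix.mul_assoc, h.precision_mul, one_mul]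
  have hweight := h.sum_abs_weight_sub_mul_precision_le V ℓ
  rw [hVT] at hweight
  have hV_sum : ∑ k, |V k ℓ| ≤ 1 + ∑ k, |(diagonal (d' - d) * T) k ℓ| +
      ∑ k, |(fitPerturbation d G X R * T) k ℓ| := by
    have hV_eq : V = 1 - diagonal (d' - d) * T + fitPerturbation d G X R * T := by
      rw [Matrix.sub_mul] at hZT
      rw [sub_add, hZT, sub_sub_cancel]
    have hone : ∑ k, |(1 : Matrix κ κ ℝ) k ℓ| = 1 := by simp [Matrix.one_apply, apply_ite abs]
    rw [← hone, ← Finset.sum_add_distrib, ← Finset.sum_add_distrib]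
    refine Finset.sum_le_sum fun k _ => ?_
    rw [hV_eq, Matrix.add_apply, Matrix.sub_apply]
    exact (abs_add_le _ _).trans (add_le_add_left (abs_sub _ _) _)
  have hsmall : 2 * K ^ 2 * δ ≤ 1 / 2 := by
    have : K ^ 2 * δ ≤ K ^ 4 * δ := by
      gcongr
      exacts [h.delta_nonneg, h.one_le, by norm_num]
    linarith [h.delta_le]
  have hV_nonneg : 0 ≤ ∑ k, |V k ℓ| := Finset.sum_nonneg fun _ _ => abs_nonneg _
  linarith [mul_le_mul_of_nonneg_right hsmall hV_nonneg]

theorem frobNorm_fitPerturbation_mul_inv_le (h : PerturbedRegression K r δ ω d d' G X R) :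
    frobNorm (fitPerturbation d G X R * (residualGram d' (X * residualCov d G + R))⁻¹) ≤ 1 := by
  have hK := h.K_pos
  have hr := h.r_pos
  have hδ := h.delta_nonneg
  have hω := h.omega_nonneg
  calc _ ≤ K ^ 3 * (5 * (ω * r) + δ) / r ^ 2 * (4 * K * r ^ 2) :=
        (frobNorm_mul_le_frobNorm_mul_l2_opNorm _ _).trans
          (mul_le_mul h.frobNorm_fitPerturbation_le h.norm_residualGram_inv_le (norm_nonneg _)
            (by positivity))
    _ = (40 * K ^ 4 * (ω * r)) / 2 + (40 * K ^ 4 * δ) / 10 := by field_simp; ring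
    _ ≤ 1 := by linarith [h.omega_le, h.delta_le]

theorem sum_sq_sum_abs_perturbation_mul_inv_le (h : PerturbedRegression K r δ ω d d' G X R) :
    ∑ ℓ, (∑ k, |((diagonal (d' - d) - fitPerturbation d G X R) *
      (residualGram d' (X * residualCov d G + R))⁻¹) k ℓ|) ^ 2 ≤ 10 * r ^ 2 := by
  have hfit := sum_sq_sum_abs_le_card_mul_frobNorm_sq
    (fitPerturbation d G X R * (residualGram d' (X * residualCov d G + R))⁻¹)
  have hfit_le := pow_le_one₀ (n := 2) (frobNorm_nonneg _) h.frobNorm_fitPerturbation_mul_inv_le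
  have hweight := h.sum_abs_weight_sub_mul_inv_le
  set T := (residualGram d' (X * residualCov d G + R))⁻¹
  have hcolumn : ∀ ℓ, (∑ k, |((diagonal (d' - d) - fitPerturbation d G X R) * T) k ℓ|) ^ 2 ≤
      2 + 8 * (∑ k, |(fitPerturbation d G X R * T) k ℓ|) ^ 2 := by
    intro ℓ
    have hsum : ∑ k, |((diagonal (d' - d) - fitPerturbation d G X R) * T) k ℓ| ≤
        1 + 2 * ∑ k, |(fitPerturbation d G X R * T) k ℓ| := by
      calc _ ≤ ∑ k, (|(diagonal (d' - d) * T) k ℓ| + |(fitPerturbation d G X R * T) k ℓ|) := by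
            refine Finset.sum_le_sum fun k _ => ?_
            rw [Matrix.sub_mul, Matrix.sub_apply]
            exact abs_sub _ _
        _ ≤ _ := by rw [Finset.sum_add_distrib]; linarith [hweight ℓ]
    refine (pow_le_pow_left₀ (Finset.sum_nonneg fun _ _ => abs_nonneg _) hsum 2).trans ?_
    linarith [sq_nonneg (1 - 2 * ∑ k, |(fitPerturbation d G X R * T) k ℓ|)]
  calc _ ≤ ∑ ℓ, (2 + 8 * (∑ k, |(fitPerturbation d G X R * T) k ℓ|) ^ 2) :=
        Finset.sum_le_sum fun ℓ _ => hcolumn ℓ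
    _ = 2 * r ^ 2 + 8 * ∑ ℓ, (∑ k, |(fitPerturbation d G X R * T) k ℓ|) ^ 2 := by
        rw [Finset.sum_add_distrib, ← Finset.mul_sum]
        simp [h.card_eq, mul_comm]
    _ ≤ 2 * r ^ 2 + 8 * (r ^ 2 * 1) := by
        rw [h.card_eq] at hfit
        linarith [mul_le_mul_of_nonneg_left hfit_le (sq_nonneg r)]
    _ = 10 * r ^ 2 := by ring

theorem sum_sq_sum_mul_plugin_error_le [Fintype ι]
    (h : PerturbedRegression K r δ ω d d' G X R) {A β E : Matrix ι κ ℝ} {ρ ω₁ : ℝ}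
    (hA : ∀ j ℓ, |A j ℓ| ≤ ρ) (hE : norm12 E ≤ ω₁) (hβA : ∀ k ℓ, |(βᵀ * A) k ℓ| ≤ K * δ) :
    ∑ ℓ, (∑ j, A j ℓ * ((β * residualCov d G + E) *
        (residualGram d' (X * residualCov d G + R))⁻¹ - β) j ℓ) ^ 2 ≤
      32 * K ^ 2 * (ρ ^ 2 * ω₁ ^ 2 * r ^ 4) + 20 * K ^ 2 * (δ ^ 2 * r ^ 2) := by
  have hT := h.norm_residualGram_inv_le
  have hZT := h.sum_sq_sum_abs_perturbation_mul_inv_le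
  rw [h.plugin_error_eq]
  set T := (residualGram d' (X * residualCov d G + R))⁻¹
  set W := (diagonal (d' - d) - fitPerturbation d G X R) * T
  have hfit : ∑ ℓ, (∑ j, A j ℓ * (E * T) j ℓ) ^ 2 ≤ ρ ^ 2 * (ω₁ * (4 * K * r ^ 2)) ^ 2 := by
    have hET : norm12 (E * T) ≤ ω₁ * (4 * K * r ^ 2) :=
      (norm12_mul_le E T).trans
        (mul_le_mul hE hT (norm_nonneg _) ((norm12_nonneg E).trans hE))
    refine (sum_sq_sum_mul_le A (E * T) hA).trans ?_
    gcongr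
    exact (sum_sq_sum_abs_le_norm12_sq _).trans (pow_le_pow_left₀ (norm12_nonneg _) hET 2)
  have hdirection : ∑ ℓ, (∑ k, (βᵀ * A) k ℓ * W k ℓ) ^ 2 ≤ (K * δ) ^ 2 * (10 * r ^ 2) :=
    (sum_sq_sum_mul_le (βᵀ * A) W hβA).trans (by gcongr)
  have hsplit : ∀ ℓ, ∑ j, A j ℓ * (E * T - β * W) j ℓ =
      ∑ j, A j ℓ * (E * T) j ℓ - ∑ k, (βᵀ * A) k ℓ * W k ℓ := by
    intro ℓ
    simp only [Matrix.sub_apply, mul_sub, Finset.sum_sub_distrib]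
    congr 1
    simp only [Matrix.mul_apply, transpose_apply, Finset.mul_sum, Finset.sum_mul]
    rw [Finset.sum_comm]
    exact Finset.sum_congr rfl fun k _ => Finset.sum_congr rfl fun j _ => by ring
  calc _ ≤ ∑ ℓ, (2 * (∑ j, A j ℓ * (E * T) j ℓ) ^ 2 +
          2 * (∑ k, (βᵀ * A) k ℓ * W k ℓ) ^ 2) := by
        refine Finset.sum_le_sum fun ℓ _ => ?_
        rw [hsplit]
        linarith [sq_nonneg (∑ j, A j ℓ * (E * T) j ℓ + ∑ k, (βᵀ * A) k ℓ * W k ℓ)]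
    _ ≤ 2 * (ρ ^ 2 * (ω₁ * (4 * K * r ^ 2)) ^ 2) + 2 * ((K * δ) ^ 2 * (10 * r ^ 2)) := by
        rw [Finset.sum_add_distrib, ← Finset.mul_sum, ← Finset.mul_sum]
        linarith
    _ = _ := by ring

end PerturbedRegression

end PluginError

/-! ### Concentration of sums -/

section Concentration

variable {𝓧 Ω : Type*} [MeasurableSpace 𝓧] [MeasurableSpace Ω] {n : ℕ} {P : Measure 𝓧}
  {μ : Measure Ω} {D : Fin n → Ω → 𝓧}

theorem exp_le_one_add_add_sq_mul_exp_abs (x : ℝ) :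
    Real.exp x ≤ 1 + x + x ^ 2 * Real.exp |x| := by
  have h := Complex.norm_exp_sub_sum_le_norm_mul_exp (x : ℂ) 2
  have hsum : ∑ m ∈ Finset.range 2, (x : ℂ) ^ m / m.factorial = ((1 + x : ℝ) : ℂ) := by
    simp [Finset.sum_range_succ]
  rw [hsum, ← Complex.ofReal_exp, ← Complex.ofReal_sub, Complex.norm_real, Complex.norm_real,
    Real.norm_eq_abs, Real.norm_eq_abs, sq_abs] at h
  linarith [le_abs_self (Real.exp x - (1 + x))]

theorem exp_mul_sub_le {l C m t z : ℝ} (hl : 0 < l) (hm : l * |m| ≤ C) (ht : |t| ≤ l / 2) :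
    Real.exp (t * (z - m)) ≤
      1 + t * (z - m) + t ^ 2 * (8 / l ^ 2 * Real.exp C) * Real.exp (l * |z|) := by
  set w := |z - m|
  have hw : 0 ≤ w := abs_nonneg _
  have hle : l * w ≤ C + l * |z| := by
    have : w ≤ |z| + |m| := abs_sub _ _
    nlinarith
  have hsq : w ^ 2 ≤ 8 / l ^ 2 * Real.exp (l / 2 * w) := by
    rw [div_mul_eq_mul_div, le_div_iff₀ (by positivity)]
    have := Real.quadratic_le_exp_of_nonneg (x := l / 2 * w) (by positivity)
    nlinarith [mul_nonneg hl.le hw]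
  have hexp : Real.exp |t * (z - m)| ≤ Real.exp (l / 2 * w) := by
    rw [Real.exp_le_exp, abs_mul]
    exact mul_le_mul_of_nonneg_right ht hw
  have hprod : Real.exp (l / 2 * w) * Real.exp (l / 2 * w) ≤
      Real.exp C * Real.exp (l * |z|) := by
    rw [← Real.exp_add, ← Real.exp_add]
    exact Real.exp_le_exp.2 (by linarith)
  calc _ ≤ 1 + t * (z - m) + (t * (z - m)) ^ 2 * Real.exp |t * (z - m)| :=
        exp_le_one_add_add_sq_mul_exp_abs _
    _ ≤ 1 + t * (z - m) + t ^ 2 * (w ^ 2 * Real.exp (l / 2 * w)) := by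
        rw [mul_pow, ← sq_abs (z - m), mul_assoc (t ^ 2)]
        gcongr
    _ ≤ 1 + t * (z - m) + t ^ 2 * (8 / l ^ 2 * Real.exp (l / 2 * w) * Real.exp (l / 2 * w)) := by
        gcongr
    _ = 1 + t * (z - m) +
        t ^ 2 * (8 / l ^ 2) * (Real.exp (l / 2 * w) * Real.exp (l / 2 * w)) := by ring
    _ ≤ 1 + t * (z - m) + t ^ 2 * (8 / l ^ 2) * (Real.exp C * Real.exp (l * |z|)) := by gcongr
    _ = _ := by ring

theorem mul_abs_integral_le_integral_exp {Z : 𝓧 → ℝ} {l : ℝ} (hl : 0 < l)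
    (hint : Integrable (fun x => Real.exp (l * |Z x|)) P) :
    l * |∫ x, Z x ∂P| ≤ ∫ x, Real.exp (l * |Z x|) ∂P := by
  rw [← abs_of_pos hl, ← abs_mul, ← integral_const_mul, abs_of_pos hl]
  refine abs_integral_le_integral_abs.trans (integral_mono_of_nonneg
    (Filter.Eventually.of_forall fun x => abs_nonneg _) hint (Filter.Eventually.of_forall ?_))
  intro x
  simp only [abs_mul, abs_of_pos hl]
  linarith [Real.add_one_le_exp (l * |Z x|)]

theorem integrable_of_integrable_exp_mul_abs {Z : 𝓧 → ℝ} (hZ : Measurable Z) {l : ℝ}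
    (hl : 0 < l) (hint : Integrable (fun x => Real.exp (l * |Z x|)) P) : Integrable Z P := by
  refine (hint.const_mul l⁻¹).mono' hZ.aestronglyMeasurable
    (Filter.Eventually.of_forall fun x => ?_)
  rw [Real.norm_eq_abs, inv_mul_eq_div, le_div_iff₀ hl, mul_comm]
  linarith [Real.add_one_le_exp (l * |Z x|)]

variable [IsProbabilityMeasure P]

theorem measureReal_le_sum_le_exp (hD : ∀ i, HasLaw (D i) P μ) (hind : iIndepFun D μ)
    {f : 𝓧 → ℝ} (hf : Measurable f) (hint : Integrable (fun x => Real.exp (f x)) P) {a : ℝ}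
    (ha : ∫ x, Real.exp (f x) ∂P ≤ Real.exp a) (s : ℝ) :
    μ.real {ω | s ≤ ∑ i, f (D i ω)} ≤ Real.exp (n * a - s) := by
  have hset : MeasurableSet {x : Fin n → 𝓧 | s ≤ ∑ i, f (x i)} :=
    measurableSet_le measurable_const
      (Finset.measurable_sum _ fun i _ => hf.comp (measurable_pi_apply i))
  have hprod : Integrable (fun x : Fin n → 𝓧 => ∏ i, Real.exp (f (x i)))
      (Measure.pi fun _ => P) := Integrable.fintype_prod fun _ => hint
  have hmarkov := mul_meas_ge_le_integral_of_nonneg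
    (Filter.Eventually.of_forall fun x => Finset.prod_nonneg fun i _ => (Real.exp_pos (f (x i))).le)
    hprod (Real.exp s)
  rw [integral_fintype_prod_eq_pow (fun x => Real.exp (f x))] at hmarkov
  simp only [← Real.exp_sum, Real.exp_le_exp, Fintype.card_fin] at hmarkov
  rw [(hind.hasLaw_pi hD).measureReal_eq (p := fun x => s ≤ ∑ i, f (x i)) hset, Real.exp_sub,
    le_div_iff₀ (Real.exp_pos s), mul_comm]
  calc _ ≤ (∫ x, Real.exp (f x) ∂P) ^ n := hmarkov
    _ ≤ Real.exp a ^ n := pow_le_pow_left₀ (integral_nonneg fun x => (Real.exp_pos _).le) ha n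
    _ = Real.exp (n * a) := (Real.exp_nat_mul a n).symm

theorem measureReal_lt_abs_sum_le (hn : 0 < n) (hD : ∀ i, HasLaw (D i) P μ)
    (hind : iIndepFun D μ) {f : 𝓧 → ℝ} (hf : Measurable f) {a t₀ : ℝ} (ha : 0 < a)
    (ht₀ : 0 ≤ t₀)
    (hmgf : ∀ t, |t| ≤ t₀ → Integrable (fun x => Real.exp (t * f x)) P ∧
      ∫ x, Real.exp (t * f x) ∂P ≤ Real.exp (a * t ^ 2))
    {s : ℝ} (hs : 0 ≤ s) (hst : s ≤ n * a * t₀ ^ 2) :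
    μ.real {ω | 2 * √(s * (n * a)) < |∑ i, f (D i ω)|} ≤ 2 * Real.exp (-s) := by
  have := (hD ⟨0, hn⟩).isProbabilityMeasure
  have hna : 0 < n * a := mul_pos (Nat.cast_pos.2 hn) ha
  obtain ⟨t, ht, htsq⟩ : ∃ t, 0 ≤ t ∧ t ^ 2 = s / (n * a) :=
    ⟨√(s / (n * a)), Real.sqrt_nonneg _, Real.sq_sqrt (by positivity)⟩
  have htle : t ≤ t₀ := le_of_sq_le_sq (by rw [htsq, div_le_iff₀ hna]; linarith) ht₀
  have hlevel : t * (2 * √(s * (n * a))) = 2 * s := by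
    have hsq : s * (n * a) = (t * (n * a)) ^ 2 := by rw [mul_pow, htsq]; field_simp
    rw [hsq, Real.sqrt_sq (by positivity)]
    have : t ^ 2 * (n * a) = s := by rw [htsq]; field_simp
    linear_combination 2 * this
  have htail : ∀ r, |r| = t →
      μ.real {ω | 2 * s ≤ ∑ i, r * f (D i ω)} ≤ Real.exp (-s) := by
    intro r hr
    obtain ⟨hint, hle⟩ := hmgf r (hr.le.trans htle)
    rw [← sq_abs, hr] at hle
    refine (measureReal_le_sum_le_exp hD hind (hf.const_mul r) hint hle (2 * s)).trans_eq ?_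
    rw [htsq]
    congr 1
    field_simp
    ring
  have hsub : {ω | 2 * √(s * (n * a)) < |∑ i, f (D i ω)|} ⊆
      {ω | 2 * s ≤ ∑ i, t * f (D i ω)} ∪ {ω | 2 * s ≤ ∑ i, -t * f (D i ω)} := by
    intro ω hω
    simp only [Set.mem_ofPred_eq, Set.mem_union, ← Finset.mul_sum, ← hlevel, neg_mul,
      Finset.sum_neg_distrib] at hω ⊢
    rw [← mul_neg]
    exact (lt_abs.1 hω).imp (fun h => mul_le_mul_of_nonneg_left h.le ht)
      (fun h => mul_le_mul_of_nonneg_left h.le ht)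
  calc _ ≤ μ.real ({ω | 2 * s ≤ ∑ i, t * f (D i ω)} ∪ {ω | 2 * s ≤ ∑ i, -t * f (D i ω)}) :=
        measureReal_mono hsub
    _ ≤ _ := measureReal_union_le _ _
    _ ≤ Real.exp (-s) + Real.exp (-s) :=
        add_le_add (htail t (abs_of_nonneg ht)) (htail (-t) (by rw [abs_neg, abs_of_nonneg ht]))
    _ = _ := by ring

theorem integral_exp_mul_sub_le {Z : 𝓧 → ℝ} (hZ : Measurable Z) {l C : ℝ} (hl : 0 < l)
    (hint : Integrable (fun x => Real.exp (l * |Z x|)) P)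
    (hC : ∫ x, Real.exp (l * |Z x|) ∂P ≤ C) {t : ℝ} (ht : |t| ≤ l / 2) :
    Integrable (fun x => Real.exp (t * (Z x - ∫ y, Z y ∂P))) P ∧
      ∫ x, Real.exp (t * (Z x - ∫ y, Z y ∂P)) ∂P ≤
        Real.exp (8 * (Real.exp C * C) / l ^ 2 * t ^ 2) := by
  set m := ∫ y, Z y ∂P with hm
  have hZint : Integrable Z P := integrable_of_integrable_exp_mul_abs hZ hl hint
  have hle := fun x => exp_mul_sub_le (z := Z x) hl
    ((mul_abs_integral_le_integral_exp hl hint).trans hC) ht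
  have hlin : Integrable (fun x => t * (Z x - m)) P :=
    (hZint.sub (integrable_const m)).const_mul t
  have haff : Integrable (fun x => 1 + t * (Z x - m)) P := (integrable_const 1).add hlin
  have hquad : Integrable
      (fun x => t ^ 2 * (8 / l ^ 2 * Real.exp C) * Real.exp (l * |Z x|)) P := hint.const_mul _
  have hexp : Integrable (fun x => Real.exp (t * (Z x - m))) P := by
    refine (haff.add hquad).mono' (by fun_prop) (Filter.Eventually.of_forall fun x => ?_)
    rw [Real.norm_eq_abs, Real.abs_exp]
    exact hle x
  have hone : ∫ x, (1 + t * (Z x - m)) ∂P = 1 := by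
    rw [integral_add (integrable_const 1) hlin, integral_const_mul,
      integral_sub hZint (integrable_const m)]
    simp [hm]
  refine ⟨hexp, ?_⟩
  calc _ ≤ ∫ x, (1 + t * (Z x - m) + t ^ 2 * (8 / l ^ 2 * Real.exp C) * Real.exp (l * |Z x|)) ∂P :=
        integral_mono hexp (haff.add hquad) hle
    _ = 1 + t ^ 2 * (8 / l ^ 2 * Real.exp C) * ∫ x, Real.exp (l * |Z x|) ∂P := by
        rw [integral_add haff hquad, hone, integral_const_mul]
    _ ≤ 1 + t ^ 2 * (8 / l ^ 2 * Real.exp C) * C := by gcongr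
    _ = 8 * (Real.exp C * C) / l ^ 2 * t ^ 2 + 1 := by ring
    _ ≤ _ := Real.add_one_le_exp _

end Concentration

/-! ### Gaussian measures -/

section Gaussian

theorem integral_exp_mul_sq_gaussianReal_zero_le {v : NNReal} {l : ℝ} (hl : 4 * l * v ≤ 1) :
    Integrable (fun x => Real.exp (l * x ^ 2)) (gaussianReal 0 v) ∧
      ∫ x, Real.exp (l * x ^ 2) ∂(gaussianReal 0 v) ≤ 2 := by
  by_cases hv : v = 0
  · subst hv
    rw [gaussianReal_zero_var]
    exact ⟨integrable_dirac (by simp), by rw [integral_dirac]; simp⟩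
  have : (0 : ℝ) < v := by positivity
  set b : ℝ := 1 / (2 * v) - l with hb
  have hle : 1 / (4 * v) ≤ b := by
    have : l ≤ 1 / (4 * v) := by
      rw [le_div_iff₀ (by positivity)]
      linarith
    have hsplit : 1 / (2 * (v : ℝ)) = 1 / (4 * v) + 1 / (4 * v) := by field_simp; norm_num
    linarith
  have hbpos : 0 < b := lt_of_lt_of_le (by positivity) hle
  have hdensity : (fun x => gaussianPDFReal 0 v x • Real.exp (l * x ^ 2)) =
      fun x => (√(2 * Real.pi * v))⁻¹ * Real.exp (-b * x ^ 2) := by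
    ext x
    rw [gaussianPDFReal, smul_eq_mul, mul_assoc, ← Real.exp_add]
    congr 2
    rw [hb]; field_simp; ring
  constructor
  · rw [gaussianReal_of_var_ne_zero _ hv, integrable_withDensity_iff_integrable_smul'
      (measurable_gaussianPDF _ _) (Filter.Eventually.of_forall fun _ => gaussianPDF_lt_top)]
    simp only [toReal_gaussianPDF, hdensity]
    exact (integrable_exp_neg_mul_sq hbpos).const_mul _
  · rw [integral_gaussianReal_eq_integral_smul hv, hdensity, integral_const_mul,
      integral_gaussian, ← Real.sqrt_inv, ← Real.sqrt_mul (by positivity)]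
    refine Real.sqrt_le_iff.2 ⟨by norm_num, ?_⟩
    calc (2 * Real.pi * v)⁻¹ * (Real.pi / b) ≤
          (2 * Real.pi * v)⁻¹ * (Real.pi / (1 / (4 * v))) := by
          have := Real.pi_pos
          gcongr
      _ = 2 := by field_simp; norm_num
      _ ≤ 2 ^ 2 := by norm_num

theorem integral_exp_mul_sq_gaussianReal_le {m l K : ℝ} {v : NNReal} (hm : |m| ≤ K)
    (hv : (v : ℝ) ≤ K) (hl : 0 < l) (hlK : 8 * l * K ≤ 1) :
    Integrable (fun x => Real.exp (l * x ^ 2)) (gaussianReal m v) ∧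
      ∫ x, Real.exp (l * x ^ 2) ∂(gaussianReal m v) ≤ 2 * Real.exp K := by
  have : 0 ≤ K := (abs_nonneg m).trans hm
  obtain ⟨hint, hle_two⟩ :=
    integral_exp_mul_sq_gaussianReal_zero_le (v := v) (l := 2 * l) (by nlinarith)
  have hmap : (gaussianReal 0 v).map (fun x => x + m) = gaussianReal m v := by
    rw [gaussianReal_map_add_const, zero_add]
  have hmeas : AEStronglyMeasurable (fun x : ℝ => Real.exp (l * x ^ 2))
      ((gaussianReal 0 v).map (fun x => x + m)) := by fun_prop
  rw [← hmap, integrable_map_measure hmeas (by fun_prop), integral_map (by fun_prop) hmeas]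
  have hle : ∀ x : ℝ, Real.exp (l * (x + m) ^ 2) ≤ Real.exp K * Real.exp (2 * l * x ^ 2) := by
    intro x
    have hsq : m ^ 2 ≤ K ^ 2 := sq_le_sq' (abs_le.1 hm).1 (abs_le.1 hm).2
    rw [← Real.exp_add, Real.exp_le_exp]
    calc l * (x + m) ^ 2 ≤ l * (2 * x ^ 2 + 2 * K ^ 2) := by
          gcongr
          nlinarith [sq_nonneg (x - m)]
      _ ≤ _ := by nlinarith
  have hshift : Integrable (fun x => Real.exp (l * (x + m) ^ 2)) (gaussianReal 0 v) := by
    refine (hint.const_mul (Real.exp K)).mono' (by fun_prop)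
      (Filter.Eventually.of_forall fun x => ?_)
    rw [Real.norm_eq_abs, Real.abs_exp]
    exact hle x
  refine ⟨hshift, (integral_mono hshift (hint.const_mul _) hle).trans ?_⟩
  rw [integral_const_mul, mul_comm]
  exact mul_le_mul_of_nonneg_right hle_two (Real.exp_pos K).le

end Gaussian

section MultivariateGaussian

variable {p : ℕ}

theorem measurable_sum_mul (v : Fin p → ℝ) :
    Measurable fun x : EuclideanSpace ℝ (Fin p) => ∑ j, v j * x j := by fun_prop

theorem sum_mul_eq_innerSL (v : Fin p → ℝ) :
    (fun x : EuclideanSpace ℝ (Fin p) => ∑ j, v j * x j) = innerSL ℝ (WithLp.toLp 2 v) := by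
  ext x
  simp [PiLp.inner_apply, mul_comm]

variable (m : EuclideanSpace ℝ (Fin p)) {S : Matrix (Fin p) (Fin p) ℝ}

theorem memLp_sum_mul_multivariateGaussian (S : Matrix (Fin p) (Fin p) ℝ) (v : Fin p → ℝ) :
    MemLp (fun x => ∑ j, v j * x j) 2 (multivariateGaussian m S) := by
  rw [sum_mul_eq_innerSL]
  exact (innerSL ℝ (WithLp.toLp 2 v)).comp_memLp' IsGaussian.memLp_two_id

theorem integral_sum_mul_multivariateGaussian (S : Matrix (Fin p) (Fin p) ℝ) (v : Fin p → ℝ) :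
    ∫ x, ∑ j, v j * x j ∂(multivariateGaussian m S) = ∑ j, v j * m j := by
  rw [sum_mul_eq_innerSL, ContinuousLinearMap.integral_comp_id_comm IsGaussian.integrable_id,
    integral_id_multivariateGaussian, ← sum_mul_eq_innerSL]

theorem map_sum_mul_multivariateGaussian (hS : S.PosSemidef) (v : Fin p → ℝ) :
    (multivariateGaussian m S).map (fun x => ∑ j, v j * x j) =
      gaussianReal (∑ j, v j * m j) (v ⬝ᵥ (S *ᵥ v)).toNNReal := by
  have hmean := integral_sum_mul_multivariateGaussian m S v
  have hvar : Var[innerSL ℝ (WithLp.toLp 2 v); multivariateGaussian m S] = v ⬝ᵥ (S *ᵥ v) := by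
    have hbilin := covarianceBilin_multivariateGaussian (μ := m) hS (WithLp.toLp 2 v)
      (WithLp.toLp 2 v)
    rw [covarianceBilin_self IsGaussian.memLp_two_id] at hbilin
    exact hbilin
  rw [sum_mul_eq_innerSL] at hmean ⊢
  rw [IsGaussian.map_eq_gaussianReal, hvar, hmean]

theorem integrable_sum_mul_mul_sum_mul_multivariateGaussian (S : Matrix (Fin p) (Fin p) ℝ)
    (u v : Fin p → ℝ) :
    Integrable (fun x => (∑ j, u j * x j) * ∑ j, v j * x j) (multivariateGaussian m S) :=
  (memLp_sum_mul_multivariateGaussian m S u).integrable_mul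
    (memLp_sum_mul_multivariateGaussian m S v)

theorem integral_sum_mul_mul_sum_mul_multivariateGaussian (hS : S.PosSemidef)
    (u v : Fin p → ℝ) :
    ∫ x, (∑ j, u j * x j) * (∑ j, v j * x j) ∂(multivariateGaussian m S) =
      u ⬝ᵥ (S *ᵥ v) + (∑ j, u j * m j) * ∑ j, v j * m j := by
  have hcov : cov[fun x => ∑ j, u j * x j, fun x => ∑ j, v j * x j; multivariateGaussian m S] =
      u ⬝ᵥ (S *ᵥ v) := by
    have hbilin := covarianceBilin_multivariateGaussian (μ := m) hS (WithLp.toLp 2 u)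
      (WithLp.toLp 2 v)
    rw [covarianceBilin_apply_eq_cov IsGaussian.memLp_two_id] at hbilin
    rw [sum_mul_eq_innerSL, sum_mul_eq_innerSL]
    exact hbilin
  rw [covariance_eq_sub (memLp_sum_mul_multivariateGaussian m S u)
    (memLp_sum_mul_multivariateGaussian m S v), integral_sum_mul_multivariateGaussian,
    integral_sum_mul_multivariateGaussian, sub_eq_iff_eq_add] at hcov
  simpa only [Pi.mul_apply] using hcov

theorem integral_exp_mul_sub_multivariateGaussian (hS : S.PosSemidef) (v : Fin p → ℝ) (t : ℝ) :
    Integrable (fun x => Real.exp (t * (∑ j, v j * (x j - m j)))) (multivariateGaussian m S) ∧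
      ∫ x, Real.exp (t * (∑ j, v j * (x j - m j))) ∂(multivariateGaussian m S) =
        Real.exp ((v ⬝ᵥ (S *ᵥ v)) * t ^ 2 / 2) := by
  have hlaw := map_sum_mul_multivariateGaussian m hS v
  set a := ∑ j, v j * m j with ha
  have hfun : (fun x : EuclideanSpace ℝ (Fin p) => Real.exp (t * (∑ j, v j * (x j - m j)))) =
      fun x => (fun y => Real.exp (-(t * a)) * Real.exp (t * y)) (∑ j, v j * x j) := by
    ext x
    simp only [mul_sub, Finset.sum_sub_distrib]
    rw [← Real.exp_add, ← ha]
    congr 1; ring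
  have hvar : 0 ≤ v ⬝ᵥ (S *ᵥ v) := by simpa using hS.dotProduct_mulVec_nonneg v
  have hmeas : AEStronglyMeasurable (fun y : ℝ => Real.exp (-(t * a)) * Real.exp (t * y))
      ((multivariateGaussian m S).map fun x => ∑ j, v j * x j) := by fun_prop
  rw [hfun]
  constructor
  · refine (integrable_map_measure hmeas (measurable_sum_mul v).aemeasurable).1 ?_
    rw [hlaw]
    exact (integrable_exp_mul_gaussianReal t).const_mul _
  · have hmgf := congrFun (mgf_fun_id_gaussianReal (μ := a) (v := (v ⬝ᵥ (S *ᵥ v)).toNNReal)) t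
    rw [mgf] at hmgf
    rw [← integral_map (measurable_sum_mul v).aemeasurable hmeas, hlaw, integral_const_mul, hmgf,
      Real.coe_toNNReal _ hvar, ← Real.exp_add]
    congr 1; ring

theorem integral_exp_mul_sq_multivariateGaussian_le (hS : S.PosSemidef) (v : Fin p → ℝ)
    {K l : ℝ} (hm : |∑ j, v j * m j| ≤ K) (hv : v ⬝ᵥ (S *ᵥ v) ≤ K) (hl : 0 < l)
    (hlK : 8 * l * K ≤ 1) :
    Integrable (fun x => Real.exp (l * (∑ j, v j * x j) ^ 2)) (multivariateGaussian m S) ∧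
      ∫ x, Real.exp (l * (∑ j, v j * x j) ^ 2) ∂(multivariateGaussian m S) ≤
        2 * Real.exp K := by
  obtain ⟨hint, hle⟩ := integral_exp_mul_sq_gaussianReal_le (v := (v ⬝ᵥ (S *ᵥ v)).toNNReal) hm
    (by rw [Real.coe_toNNReal']; exact max_le hv ((abs_nonneg _).trans hm)) hl hlK
  rw [← map_sum_mul_multivariateGaussian m hS v] at hint hle
  have hmeas : AEStronglyMeasurable (fun y : ℝ => Real.exp (l * y ^ 2))
      ((multivariateGaussian m S).map fun x => ∑ j, v j * x j) := by fun_prop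
  rw [integral_map (measurable_sum_mul v).aemeasurable hmeas] at hle
  exact ⟨(integrable_map_measure hmeas (measurable_sum_mul v).aemeasurable).1 hint, hle⟩

theorem integrable_eval_multivariateGaussian (S : Matrix (Fin p) (Fin p) ℝ) (j : Fin p) :
    Integrable (fun x => x j) (multivariateGaussian m S) :=
  (EuclideanSpace.proj (𝕜 := ℝ) j).integrable_comp IsGaussian.integrable_id

theorem integral_eval_multivariateGaussian (S : Matrix (Fin p) (Fin p) ℝ) (j : Fin p) :
    ∫ x, x j ∂(multivariateGaussian m S) = m j := by
  simpa [Pi.single_apply] using integral_sum_mul_multivariateGaussian m S (Pi.single j 1)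

end MultivariateGaussian

/-! ### Moments of the linear discriminant model -/

section Model

variable {p L : ℕ} {P : Measure (Obs p L)} {M : Matrix (Fin p) (Fin L) ℝ}
  {SW : Matrix (Fin p) (Fin p) ℝ}

theorem ae_eq_cond_snd_eq {f : Obs p L → ℝ} (ℓ : Fin L) :
    f =ᵐ[P[|{z | z.2 = ℓ}]] fun z => f (z.1, ℓ) := by
  filter_upwards [ae_cond_mem (measurable_snd (measurableSet_singleton ℓ))] with z hz
  have hz' : z.2 = ℓ := hz
  rw [← hz']

theorem IsLDAModel.integrable_cond (hP : IsLDAModel P M SW) {f : Obs p L → ℝ}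
    (hf : Measurable f) {ℓ : Fin L} (h : Integrable (fun x => f (x, ℓ))
      (multivariateGaussian (WithLp.toLp 2 (fun j => M j ℓ)) SW)) :
    Integrable f P[|{z | z.2 = ℓ}] := by
  have hfℓ : Measurable fun x : EuclideanSpace ℝ (Fin p) => f (x, ℓ) := hf.comp (by fun_prop)
  rw [← (hP.gaussian ℓ).map_eq,
    integrable_map_measure hfℓ.aestronglyMeasurable measurable_fst.aemeasurable] at h
  exact h.congr (ae_eq_cond_snd_eq ℓ).symm

theorem IsLDAModel.integral_cond (hP : IsLDAModel P M SW) {f : Obs p L → ℝ}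
    (hf : Measurable f) (ℓ : Fin L) :
    ∫ z, f z ∂P[|{z | z.2 = ℓ}] =
      ∫ x, f (x, ℓ) ∂(multivariateGaussian (WithLp.toLp 2 (fun j => M j ℓ)) SW) := by
  have hfℓ : Measurable fun x : EuclideanSpace ℝ (Fin p) => f (x, ℓ) := hf.comp (by fun_prop)
  rw [integral_congr_ae (ae_eq_cond_snd_eq ℓ)]
  exact (hP.gaussian ℓ).integral_comp hfℓ.aestronglyMeasurable

theorem IsLDAModel.integral_eq_sum (hP : IsLDAModel P M SW) {f : Obs p L → ℝ} (hf : Measurable f)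
    (h : ∀ ℓ, Integrable (fun x => f (x, ℓ))
      (multivariateGaussian (WithLp.toLp 2 (fun j => M j ℓ)) SW)) :
    Integrable f P ∧ ∫ z, f z ∂P = ∑ ℓ, classProb P ℓ *
      ∫ x, f (x, ℓ) ∂(multivariateGaussian (WithLp.toLp 2 (fun j => M j ℓ)) SW) := by
  have := hP.isProbabilityMeasure
  have hmix : ∑ ℓ, P {z | z.2 = ℓ} • P[|{z | z.2 = ℓ}] = P :=
    sum_meas_smul_cond_fiber measurable_snd P
  have hint : ∀ ℓ ∈ Finset.univ, Integrable f (P {z | z.2 = ℓ} • P[|{z | z.2 = ℓ}]) :=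
    fun ℓ _ => (hP.integrable_cond hf (h ℓ)).smul_measure (measure_ne_top _ _)
  constructor
  · rw [← hmix]
    exact integrable_finsetSum_measure.2 hint
  · conv_lhs => rw [← hmix]
    rw [integral_finsetSum_measure hint]
    refine Finset.sum_congr rfl fun ℓ _ => ?_
    rw [integral_smul_measure, hP.integral_cond hf, smul_eq_mul]
    rfl

theorem IsLDAModel.sum_classProb (hP : IsLDAModel P M SW) : ∑ ℓ, classProb P ℓ = 1 := by
  have := hP.isProbabilityMeasure
  have h := (hP.integral_eq_sum (f := fun _ => 1) measurable_const fun ℓ => integrable_const _).2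
  simpa using h.symm

theorem IsLDAModel.integral_mul_eq (hP : IsLDAModel P M SW) (u v : Fin p → ℝ) :
    ∫ z, (∑ j, u j * z.1 j) * (∑ j, v j * z.1 j) ∂P = u ⬝ᵥ (SW *ᵥ v) +
      ∑ ℓ, classProb P ℓ * ((∑ j, u j * M j ℓ) * ∑ j, v j * M j ℓ) := by
  rw [(hP.integral_eq_sum (f := fun z => (∑ j, u j * z.1 j) * (∑ j, v j * z.1 j)) (by fun_prop)
    fun ℓ => integrable_sum_mul_mul_sum_mul_multivariateGaussian _ SW u v).2]
  simp only [integral_sum_mul_mul_sum_mul_multivariateGaussian _ hP.posDef.posSemidef, mul_add,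
    Finset.sum_add_distrib]
  rw [← Finset.sum_mul, hP.sum_classProb, one_mul]

theorem IsLDAModel.sum_classProb_mul_mean (hP : IsLDAModel P M SW) (j : Fin p) :
    ∑ ℓ, classProb P ℓ * M j ℓ = 0 := by
  rw [← hP.mean_zero j, (hP.integral_eq_sum (f := fun z => z.1 j) (by fun_prop)
    fun ℓ => integrable_eval_multivariateGaussian _ SW j).2]
  simp only [integral_eval_multivariateGaussian]

theorem IsLDAModel.memLp_eval (hP : IsLDAModel P M SW) (j : Fin p) :
    MemLp (fun z : Obs p L => z.1 j) 2 P := by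
  have hmeas : Measurable fun z : Obs p L => z.1 j := by fun_prop
  rw [memLp_two_iff_integrable_sq hmeas.aestronglyMeasurable]
  refine (hP.integral_eq_sum (f := fun z => z.1 j ^ 2) (by fun_prop) fun ℓ => ?_).1
  simpa [Pi.single_apply, sq] using integrable_sum_mul_mul_sum_mul_multivariateGaussian
    (WithLp.toLp 2 (fun j => M j ℓ)) SW (Pi.single j 1) (Pi.single j 1)

theorem IsLDAModel.covX_eq (hP : IsLDAModel P M SW) :
    covX P = SW + M * diagonal (classProb P) * Mᵀ := by
  have := hP.isProbabilityMeasure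
  ext i j
  have hmoment := hP.integral_mul_eq (Pi.single i 1) (Pi.single j 1)
  simp only [Pi.single_apply, ite_mul, one_mul, zero_mul, Finset.sum_ite_eq', Finset.mem_univ,
    if_true] at hmoment
  rw [covX, of_apply, covariance_eq_sub (hP.memLp_eval i) (hP.memLp_eval j), hP.mean_zero,
    zero_mul, sub_zero]
  simp only [Pi.mul_apply, hmoment, Matrix.add_apply]
  congr 1
  · simp
  · rw [Matrix.mul_apply]
    refine Finset.sum_congr rfl fun ℓ _ => ?_
    rw [mul_diagonal, transpose_apply]; ring

theorem measurable_oneHot (ℓ : Fin L) : Measurable fun z : Obs p L => oneHot z.2 ℓ :=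
  (measurable_from_top (f := fun k : Fin L => oneHot k ℓ)).comp measurable_snd

theorem IsLDAModel.covXY_eq (hP : IsLDAModel P M SW) :
    covXY P = M * diagonal (classProb P) := by
  have := hP.isProbabilityMeasure
  ext i ℓ
  have hmem : MemLp (fun z : Obs p L => oneHot z.2 ℓ) 2 P :=
    MemLp.of_bound (measurable_oneHot ℓ).aestronglyMeasurable 1
      (Filter.Eventually.of_forall fun z => by rw [oneHot]; split_ifs <;> simp)
  have hclass : ∀ k : Fin L, ∫ x, x i * oneHot k ℓ
      ∂(multivariateGaussian (WithLp.toLp 2 (fun j => M j k)) SW) = M i k * oneHot k ℓ := by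
    intro k
    rw [integral_mul_const, integral_eval_multivariateGaussian]
  have hmix := (hP.integral_eq_sum (f := fun z => z.1 i * oneHot z.2 ℓ)
    (Measurable.mul (by fun_prop) (measurable_oneHot ℓ))
    fun k => (integrable_eval_multivariateGaussian _ SW i).mul_const (oneHot k ℓ)).2
  rw [covXY, of_apply, covariance_eq_sub (hP.memLp_eval i) hmem, hP.mean_zero, zero_mul, sub_zero,
    mul_diagonal]
  simp only [Pi.mul_apply, hmix, hclass]
  simp [oneHot, mul_comm]

end Model

/-! ### The regression matrix and the discriminant directions -/

section Directions

theorem apply_comm_of_posSemidef {ι : Type*} {G : Matrix ι ι ℝ} (hG : G.PosSemidef) (i j : ι) :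
    G j i = G i j := by
  simpa [conjTranspose_apply] using congrFun (congrFun hG.isHermitian i) j

theorem abs_apply_le_of_posSemidef {ι : Type*} [Finite ι] {G : Matrix ι ι ℝ}
    (hG : G.PosSemidef) {a : ℝ} (ha : ∀ i, G i i ≤ a) (i j : ι) : |G i j| ≤ a := by
  classical
  have := Fintype.ofFinite ι
  have hadd := hG.dotProduct_mulVec_nonneg (Pi.single i 1 + Pi.single j 1)
  have hsub := hG.dotProduct_mulVec_nonneg (Pi.single i 1 - Pi.single j 1)
  simp only [star_trivial, mulVec_add, mulVec_sub, mulVec_single_one, dotProduct_add,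
    dotProduct_sub, add_dotProduct, sub_dotProduct, single_one_dotProduct, col_apply,
    apply_comm_of_posSemidef hG i j] at hadd hsub
  rw [abs_le]
  constructor <;> linarith [ha i, ha j]

variable {p L : ℕ} {P : Measure (Obs p L)} {M : Matrix (Fin p) (Fin L) ℝ}
  {SW : Matrix (Fin p) (Fin p) ℝ}

/-- The Gram matrix `Mᵀ Σ_W⁻¹ M` of the class means in the Mahalanobis inner product; it is also
the within-class covariance matrix of the discriminant scores `(B*)ᵀ X`. -/
noncomputable def discGram (SW : Matrix (Fin p) (Fin p) ℝ) (M : Matrix (Fin p) (Fin L) ℝ) :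
    Matrix (Fin L) (Fin L) ℝ :=
  Mᵀ * discB SW M

theorem discGram_posSemidef (hSW : SW.PosDef) (M : Matrix (Fin p) (Fin L) ℝ) :
    (discGram SW M).PosSemidef := by
  have := hSW.inv.posSemidef.conjTranspose_mul_mul_same M
  rwa [conjTranspose_eq_transpose_of_trivial, Matrix.mul_assoc] at this

theorem mul_discB (hSW : SW.PosDef) (M : Matrix (Fin p) (Fin L) ℝ) : SW * discB SW M = M := by
  rw [discB, mul_nonsing_inv_cancel_left _ _ ((isUnit_iff_isUnit_det _).1 hSW.isUnit)]

theorem discB_transpose_mul (hSW : SW.PosDef) (M : Matrix (Fin p) (Fin L) ℝ) :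
    (discB SW M)ᵀ * M = discGram SW M := by
  have hinv : (SW⁻¹)ᵀ = SW⁻¹ := by
    rw [← conjTranspose_eq_transpose_of_trivial]
    exact hSW.inv.isHermitian
  rw [discGram, discB, transpose_mul, hinv, Matrix.mul_assoc]

theorem sqrt_mul_discB_transpose_mul_self (hSW : SW.PosDef) (M : Matrix (Fin p) (Fin L) ℝ) :
    (CFC.sqrt SW * discB SW M)ᵀ * (CFC.sqrt SW * discB SW M) = discGram SW M := by
  have hsymm : (CFC.sqrt SW)ᵀ = CFC.sqrt SW := by
    rw [← conjTranspose_eq_transpose_of_trivial]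
    exact (Matrix.nonneg_iff_posSemidef.1 (CFC.sqrt_nonneg SW)).isHermitian
  have hsq : CFC.sqrt SW * CFC.sqrt SW = SW :=
    CFC.sqrt_mul_sqrt_self SW (Matrix.nonneg_iff_posSemidef.2 hSW.posSemidef)
  rw [transpose_mul, hsymm, Matrix.mul_assoc, ← Matrix.mul_assoc (CFC.sqrt SW), hsq,
    mul_discB hSW, discB_transpose_mul hSW]

theorem discB_dotProduct_mulVec (hSW : SW.PosDef) (M : Matrix (Fin p) (Fin L) ℝ) (k ℓ : Fin L) :
    (fun j => discB SW M j k) ⬝ᵥ (SW *ᵥ fun j => discB SW M j ℓ) = discGram SW M k ℓ := by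
  rw [← discB_transpose_mul hSW, ← congrArg ((discB SW M)ᵀ * ·) (mul_discB hSW M),
    Matrix.mul_apply]
  rfl

theorem sum_discB_mul (hSW : SW.PosDef) (M : Matrix (Fin p) (Fin L) ℝ) (k ℓ : Fin L) :
    ∑ j, discB SW M j k * M j ℓ = discGram SW M k ℓ := by
  rw [← discB_transpose_mul hSW, Matrix.mul_apply]
  rfl

theorem mahal_eq (hSW : SW.PosDef) (M : Matrix (Fin p) (Fin L) ℝ) (k ℓ : Fin L) :
    mahal SW M k ℓ = discGram SW M k k + discGram SW M ℓ ℓ - 2 * discGram SW M k ℓ := by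
  have hinner : ∀ k ℓ, (fun j => M j k) ⬝ᵥ (SW⁻¹ *ᵥ fun j => M j ℓ) = discGram SW M k ℓ := by
    intro k ℓ
    rw [discGram, discB, Matrix.mul_apply]
    rfl
  have hsub : (fun j => M j k - M j ℓ) = (fun j => M j k) - fun j => M j ℓ := rfl
  rw [mahal, hsub, mulVec_sub, dotProduct_sub, sub_dotProduct, sub_dotProduct, hinner, hinner,
    hinner, hinner, apply_comm_of_posSemidef (discGram_posSemidef hSW M) k ℓ]
  ring

theorem diagonal_mul_diagonal_inv {κ : Type*} [Fintype κ] [DecidableEq κ] {d : κ → ℝ}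
    (hd : ∀ ℓ, d ℓ ≠ 0) : diagonal d * diagonal (fun ℓ => (d ℓ)⁻¹) = 1 := by
  rw [diagonal_mul_diagonal, ← diagonal_one]
  exact congrArg _ (funext fun ℓ => mul_inv_cancel₀ (hd ℓ))

namespace IsLDAModel

theorem sum_classProb_mul_discGram (hP : IsLDAModel P M SW) (ℓ : Fin L) :
    ∑ k, classProb P k * discGram SW M k ℓ = 0 := by
  simp only [discGram, Matrix.mul_apply, transpose_apply, Finset.mul_sum]
  rw [Finset.sum_comm]
  refine Finset.sum_eq_zero fun j _ => ?_
  simp only [← mul_assoc, ← Finset.sum_mul]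
  rw [hP.sum_classProb_mul_mean, zero_mul]

theorem sum_classProb_mul_mahal (hP : IsLDAModel P M SW) (ℓ : Fin L) :
    ∑ k, classProb P k * mahal SW M k ℓ =
      ∑ k, classProb P k * discGram SW M k k + discGram SW M ℓ ℓ := by
  have hterm : ∀ k, classProb P k * mahal SW M k ℓ = classProb P k * discGram SW M k k +
      classProb P k * discGram SW M ℓ ℓ - 2 * (classProb P k * discGram SW M k ℓ) := fun k => by
    rw [mahal_eq hP.posDef]; ring
  simp only [hterm]
  rw [Finset.sum_sub_distrib, Finset.sum_add_distrib, ← Finset.sum_mul, ← Finset.mul_sum,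
    hP.sum_classProb, hP.sum_classProb_mul_discGram]
  ring

-- As the class means are centred, `μ_ℓᵀ Σ_W⁻¹ μ_ℓ` is at most the average of the squared distances
-- from `μ_ℓ` to the other means.
theorem abs_discGram_le (hP : IsLDAModel P M SW) {a : ℝ} (ha : ∀ k ℓ, mahal SW M k ℓ ≤ a)
    (k ℓ : Fin L) : |discGram SW M k ℓ| ≤ a := by
  refine abs_apply_le_of_posSemidef (discGram_posSemidef hP.posDef M) (fun ℓ => ?_) k ℓ
  have htrace : 0 ≤ ∑ k, classProb P k * discGram SW M k k := Finset.sum_nonneg fun k _ =>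
    mul_nonneg (hP.classProb_pos k).le (discGram_posSemidef hP.posDef M).diag_nonneg
  calc discGram SW M ℓ ℓ ≤ ∑ k, classProb P k * mahal SW M k ℓ := by
        rw [hP.sum_classProb_mul_mahal]
        linarith
    _ ≤ ∑ k, classProb P k * a := Finset.sum_le_sum fun k _ =>
        mul_le_mul_of_nonneg_left (ha k ℓ) (hP.classProb_pos k).le
    _ = a := by rw [← Finset.sum_mul, hP.sum_classProb, one_mul]

theorem covX_posDef (hP : IsLDAModel P M SW) : (covX P).PosDef := by
  have hbetween := (PosSemidef.diagonal
    fun ℓ => (hP.classProb_pos ℓ).le).mul_mul_conjTranspose_same M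
  rw [conjTranspose_eq_transpose_of_trivial] at hbetween
  rw [hP.covX_eq]
  exact hP.posDef.add_posSemidef hbetween

theorem covX_mul_discB (hP : IsLDAModel P M SW) :
    covX P * discB SW M = M * diagonal (classProb P) *
      (diagonal (fun ℓ => (classProb P ℓ)⁻¹) + discGram SW M) := by
  rw [hP.covX_eq, Matrix.add_mul, mul_discB hP.posDef, Matrix.mul_add,
    Matrix.mul_assoc M (diagonal _) (diagonal _),
    diagonal_mul_diagonal_inv fun ℓ => (hP.classProb_pos ℓ).ne', Matrix.mul_one, discGram]
  simp only [Matrix.mul_assoc]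

theorem regB_eq (hP : IsLDAModel P M SW) :
    regB P = discB SW M * residualCov (classProb P) (discGram SW M) := by
  have hprec : (diagonal (fun ℓ => (classProb P ℓ)⁻¹) + discGram SW M).PosDef :=
    (PosDef.diagonal fun ℓ => inv_pos.2 (hP.classProb_pos ℓ)).add_posSemidef
      (discGram_posSemidef hP.posDef M)
  rw [residualCov, regB, hP.covXY_eq]
  calc _ = (covX P)⁻¹ * (M * diagonal (classProb P) *
          ((diagonal (fun ℓ => (classProb P ℓ)⁻¹) + discGram SW M) *
            (diagonal (fun ℓ => (classProb P ℓ)⁻¹) + discGram SW M)⁻¹)) := by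
        rw [mul_nonsing_inv _ ((isUnit_iff_isUnit_det _).1 hprec.isUnit), Matrix.mul_one]
    _ = (covX P)⁻¹ * (covX P * discB SW M *
          (diagonal (fun ℓ => (classProb P ℓ)⁻¹) + discGram SW M)⁻¹) := by
        rw [hP.covX_mul_discB]; simp only [Matrix.mul_assoc]
    _ = _ := by
        rw [Matrix.mul_assoc, nonsing_inv_mul_cancel_left _ _
          ((isUnit_iff_isUnit_det _).1 hP.covX_posDef.isUnit)]

theorem integral_discB_mul (hP : IsLDAModel P M SW) (k ℓ : Fin L) :
    ∫ z, (∑ j, discB SW M j k * z.1 j) * (∑ j, discB SW M j ℓ * z.1 j) ∂P =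
      (discGram SW M * diagonal (classProb P) *
        (diagonal (fun ℓ => (classProb P ℓ)⁻¹) + discGram SW M)) k ℓ := by
  rw [hP.integral_mul_eq, discB_dotProduct_mulVec hP.posDef]
  simp only [sum_discB_mul hP.posDef]
  rw [Matrix.mul_add, Matrix.mul_assoc (discGram SW M),
    diagonal_mul_diagonal_inv fun ℓ => (hP.classProb_pos ℓ).ne', Matrix.mul_one,
    Matrix.add_apply, Matrix.mul_apply]
  congr 1
  refine Finset.sum_congr rfl fun m _ => ?_
  rw [mul_diagonal, apply_comm_of_posSemidef (discGram_posSemidef hP.posDef M) m ℓ]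
  ring

end IsLDAModel

end Directions

/-! ### Sample moments -/

section SampleMoments

variable {n p L : ℕ}

/-- The number of observations in class `ℓ`, as a real number. -/
noncomputable def classCount (D : Fin n → Obs p L) (ℓ : Fin L) : ℝ := ∑ i, oneHot (D i).2 ℓ

/-- The sum of the centred scores `vᵀ (X_i - μ_ℓ)` over the observations of class `ℓ`. -/
noncomputable def centredClassSum (M : Matrix (Fin p) (Fin L) ℝ) (D : Fin n → Obs p L)
    (v : Fin p → ℝ) (ℓ : Fin L) : ℝ :=
  ∑ i, oneHot (D i).2 ℓ * ∑ j, v j * ((D i).1 j - M j ℓ)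

/-- The feature matrix scaled by `n^{-1/2}`, so that its Gram matrix is the matrix of sample
second moments. -/
noncomputable def scaledFeat (D : Fin n → Obs p L) : Matrix (Fin n) (Fin p) ℝ :=
  (1 / √n) • featMat D

theorem sum_oneHot_sub (D : Fin n → Obs p L) (ℓ : Fin L) (a : ℝ) :
    ∑ i, (oneHot (D i).2 ℓ - a) = classCount D ℓ - n * a := by
  rw [Finset.sum_sub_distrib, classCount]
  simp

theorem respMat_transpose_mul_self (D : Fin n → Obs p L) :
    (respMat D)ᵀ * respMat D = diagonal (classCount D) := by
  ext k ℓ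
  simp only [Matrix.mul_apply, diagonal_apply, transpose_apply, respMat, of_apply, classCount]
  split_ifs with hkℓ
  · subst hkℓ
    exact Finset.sum_congr rfl fun i _ => by rw [oneHot]; split_ifs <;> simp
  · refine Finset.sum_eq_zero fun i _ => ?_
    simp only [oneHot, mul_ite, mul_one, mul_zero]
    split_ifs with hℓ hk
    · exact absurd (hk.symm.trans hℓ) hkℓ
    · rfl
    · rfl

theorem meanEst_apply {D : Fin n → Obs p L} (hD : ∀ ℓ, classCount D ℓ ≠ 0) (j : Fin p)
    (ℓ : Fin L) :
    meanEst D j ℓ = (∑ i, oneHot (D i).2 ℓ * (D i).1 j) / classCount D ℓ := by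
  rw [meanEst, respMat_transpose_mul_self, inv_eq_right_inv (diagonal_mul_diagonal_inv hD),
    mul_diagonal, Matrix.mul_apply, div_eq_mul_inv]
  congr 1
  exact Finset.sum_congr rfl fun i _ => by simp [featMat, respMat, mul_comm]

theorem sum_mul_meanEst_sub {D : Fin n → Obs p L} (hD : ∀ ℓ, classCount D ℓ ≠ 0)
    (M : Matrix (Fin p) (Fin L) ℝ) (v : Fin p → ℝ) (ℓ : Fin L) :
    ∑ j, v j * (meanEst D j ℓ - M j ℓ) = centredClassSum M D v ℓ / classCount D ℓ := by
  have hcentre : ∀ j, meanEst D j ℓ - M j ℓ =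
      (∑ i, oneHot (D i).2 ℓ * ((D i).1 j - M j ℓ)) / classCount D ℓ := fun j => by
    rw [meanEst_apply hD, eq_div_iff (hD ℓ), sub_mul, div_mul_cancel₀ _ (hD ℓ)]
    simp only [mul_sub, Finset.sum_sub_distrib]
    rw [← Finset.sum_mul, ← classCount, mul_comm (M j ℓ)]
  simp only [hcentre, centredClassSum, Finset.mul_sum, Finset.sum_div]
  rw [Finset.sum_comm]
  exact Finset.sum_congr rfl fun i _ => Finset.sum_congr rfl fun j _ => by ring

theorem scaledFeat_mul_gram (D : Fin n → Obs p L) (A : Matrix (Fin p) (Fin L) ℝ) :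
    (scaledFeat D * A)ᵀ * (scaledFeat D * A) =
      (1 / (n : ℝ)) • ((featMat D * A)ᵀ * (featMat D * A)) := by
  rw [scaledFeat, Matrix.smul_mul, transpose_smul, Matrix.smul_mul, Matrix.mul_smul, smul_smul,
    div_mul_div_comm, Real.mul_self_sqrt (Nat.cast_nonneg n), one_mul]

theorem scaledFeat_mul_gram_apply (D : Fin n → Obs p L) (A : Matrix (Fin p) (Fin L) ℝ)
    (k ℓ : Fin L) :
    ((scaledFeat D * A)ᵀ * (scaledFeat D * A)) k ℓ =
      (∑ i, (∑ j, A j k * (D i).1 j) * ∑ j, A j ℓ * (D i).1 j) / n := by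
  rw [scaledFeat_mul_gram, Matrix.smul_apply, smul_eq_mul, one_div_mul_eq_div]
  simp only [transpose_apply, Matrix.mul_apply, featMat, of_apply, mul_comm]

theorem plugH_eq (D : Fin n → Obs p L) (A : Matrix (Fin p) (Fin L) ℝ) :
    plugH D A = residualGram (fun ℓ => classCount D ℓ / n) (scaledFeat D * A) := by
  have hfreq : diagonal (fun ℓ => classCount D ℓ / n) =
      (1 / (n : ℝ)) • diagonal (classCount D) := by
    rw [← diagonal_smul]
    exact congrArg _ (funext fun ℓ => by simp [div_eq_inv_mul])
  rw [plugH, residualGram, respMat_transpose_mul_self, smul_sub, hfreq, scaledFeat_mul_gram,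
    transpose_mul]
  simp only [Matrix.mul_assoc]

end SampleMoments

/-! ### Deviations of the sample moments -/

section Deviations

variable {n p L : ℕ} {P : Measure (Obs p L)} {M : Matrix (Fin p) (Fin L) ℝ}
  {SW : Matrix (Fin p) (Fin p) ℝ} {Ω : Type*} [MeasurableSpace Ω] {μ : Measure Ω}
  {D : Fin n → Ω → Obs p L}

namespace IsLDAModel

theorem integral_exp_mul_oneHot_sub_le (hP : IsLDAModel P M SW) (ℓ : Fin L) {t : ℝ}
    (ht : |t| ≤ 1) :
    Integrable (fun z => Real.exp (t * (oneHot z.2 ℓ - classProb P ℓ))) P ∧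
      ∫ z, Real.exp (t * (oneHot z.2 ℓ - classProb P ℓ)) ∂P ≤
        Real.exp (classProb P ℓ * t ^ 2) := by
  have := hP.isProbabilityMeasure
  set q := classProb P ℓ with hq
  obtain ⟨hint, hmix⟩ := hP.integral_eq_sum (f := fun z => Real.exp (t * (oneHot z.2 ℓ - q)))
    (Real.measurable_exp.comp (((measurable_oneHot ℓ).sub_const q).const_mul t))
    fun k => integrable_const (Real.exp (t * (oneHot k ℓ - q)))
  have hterm : ∀ k : Fin L, Real.exp (t * (oneHot k ℓ - q)) =
      Real.exp (-(t * q)) * (1 + if k = ℓ then Real.exp t - 1 else 0) := fun k => by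
    rw [oneHot]
    split_ifs
    · rw [mul_sub, mul_one, sub_eq_add_neg t, Real.exp_add]; ring
    · rw [zero_sub, mul_neg]; ring
  have hexp : Real.exp t - 1 ≤ t + t ^ 2 := by
    linarith [le_abs_self (Real.exp t - 1 - t), Real.abs_exp_sub_one_sub_id_le ht]
  refine ⟨hint, ?_⟩
  calc ∫ z, Real.exp (t * (oneHot z.2 ℓ - q)) ∂P
      = ∑ k, classProb P k *
          (Real.exp (-(t * q)) * (1 + if k = ℓ then Real.exp t - 1 else 0)) := by
        rw [hmix]
        simp only [integral_const, probReal_univ, one_smul, hterm]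
    _ = Real.exp (-(t * q)) * (1 + q * (Real.exp t - 1)) := by
        simp only [mul_left_comm (classProb P _) (Real.exp _)]
        rw [← Finset.mul_sum]
        congr 1
        simp only [mul_add, Finset.sum_add_distrib, mul_one, hP.sum_classProb, mul_ite, mul_zero,
          Finset.sum_ite_eq', Finset.mem_univ, if_true, hq]
    _ ≤ Real.exp (-(t * q)) * Real.exp (q * (Real.exp t - 1)) := by
        gcongr
        linarith [Real.add_one_le_exp (q * (Real.exp t - 1))]
    _ = Real.exp (q * (Real.exp t - 1) - t * q) := by rw [← Real.exp_add]; ring_nf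
    _ ≤ Real.exp (q * t ^ 2) := by
        refine Real.exp_le_exp.2 ?_
        nlinarith [hP.classProb_pos ℓ]

theorem measureReal_classCount_deviation_le (hP : IsLDAModel P M SW) (hn : 0 < n)
    (hD : ∀ i, HasLaw (D i) P μ) (hind : iIndepFun D μ) (ℓ : Fin L) {s : ℝ} (hs : 0 ≤ s)
    (hsn : s ≤ n * classProb P ℓ) :
    μ.real {ω | 2 * √(s * (n * classProb P ℓ)) <
      |classCount (fun i => D i ω) ℓ - n * classProb P ℓ|} ≤ 2 * Real.exp (-s) := by
  have := hP.isProbabilityMeasure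
  simp only [← sum_oneHot_sub]
  exact measureReal_lt_abs_sum_le hn hD hind (f := fun z => oneHot z.2 ℓ - classProb P ℓ)
    ((measurable_oneHot ℓ).sub_const _) (hP.classProb_pos ℓ) zero_le_one
    (fun t ht => hP.integral_exp_mul_oneHot_sub_le ℓ ht) hs (by simpa using hsn)

end IsLDAModel

theorem exp_mul_abs_mul_le (a b : ℝ) {l : ℝ} (hl : 0 ≤ l) :
    Real.exp (l * |a * b|) ≤ (Real.exp (l * a ^ 2) + Real.exp (l * b ^ 2)) / 2 := by
  have hab : 2 * |a * b| ≤ a ^ 2 + b ^ 2 := by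
    rw [abs_mul]
    nlinarith [sq_nonneg (|a| - |b|), sq_abs a, sq_abs b]
  have hsq : ∀ y : ℝ, Real.exp y = Real.exp (y / 2) ^ 2 := fun y => by
    rw [← Real.exp_nat_mul]
    congr 1
    push_cast
    ring
  calc Real.exp (l * |a * b|)
      ≤ Real.exp (l * a ^ 2 / 2) * Real.exp (l * b ^ 2 / 2) := by
        rw [← Real.exp_add]
        exact Real.exp_le_exp.2 (by nlinarith)
    _ ≤ _ := by
        rw [hsq (l * a ^ 2), hsq (l * b ^ 2)]
        nlinarith [sq_nonneg (Real.exp (l * a ^ 2 / 2) - Real.exp (l * b ^ 2 / 2))]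

theorem integral_exp_mul_abs_mul_multivariateGaussian_le (m : EuclideanSpace ℝ (Fin p))
    (hS : SW.PosSemidef) {u v : Fin p → ℝ} {K l : ℝ}
    (hum : |∑ j, u j * m j| ≤ K) (huu : u ⬝ᵥ (SW *ᵥ u) ≤ K)
    (hvm : |∑ j, v j * m j| ≤ K) (hvv : v ⬝ᵥ (SW *ᵥ v) ≤ K) (hl : 0 < l) (hlK : 8 * l * K ≤ 1) :
    Integrable (fun x => Real.exp (l * |(∑ j, u j * x j) * ∑ j, v j * x j|))
        (multivariateGaussian m SW) ∧
      ∫ x, Real.exp (l * |(∑ j, u j * x j) * ∑ j, v j * x j|) ∂(multivariateGaussian m SW) ≤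
        2 * Real.exp K := by
  obtain ⟨hu, hu_le⟩ := integral_exp_mul_sq_multivariateGaussian_le m hS u hum huu hl hlK
  obtain ⟨hv, hv_le⟩ := integral_exp_mul_sq_multivariateGaussian_le m hS v hvm hvv hl hlK
  have hle := fun x : EuclideanSpace ℝ (Fin p) =>
    exp_mul_abs_mul_le (∑ j, u j * x j) (∑ j, v j * x j) hl.le
  have hmeas : Measurable fun x : EuclideanSpace ℝ (Fin p) =>
      Real.exp (l * |(∑ j, u j * x j) * ∑ j, v j * x j|) := by fun_prop
  have hmean := (hu.add hv).div_const 2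
  have hint := hmean.mono' hmeas.aestronglyMeasurable (Filter.Eventually.of_forall fun x => by
    rw [Real.norm_eq_abs, Real.abs_exp]
    exact hle x)
  refine ⟨hint, (integral_mono hint hmean hle).trans ?_⟩
  simp only [Pi.add_apply]
  rw [integral_div, integral_add hu hv]
  linarith

/-- The variance proxy in the Bernstein bound for products of two linear scores whose means and
variances within the classes are at most `K`: the constant that `integral_exp_mul_sub_le` yields
for the exponential moment bound `2 exp K` at `l = 1 / (8 K)`. -/
noncomputable def momentConst (K : ℝ) : ℝ :=
  8 * (Real.exp (2 * Real.exp K) * (2 * Real.exp K)) / (1 / (8 * K)) ^ 2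

theorem momentConst_pos {K : ℝ} (hK : 0 < K) : 0 < momentConst K := by
  rw [momentConst]
  positivity

theorem one_le_momentConst_mul_sq {K : ℝ} (hK : 0 < K) :
    1 ≤ momentConst K * (1 / (8 * K) / 2) ^ 2 := by
  have hconst : momentConst K * (1 / (8 * K) / 2) ^ 2 =
      4 * (Real.exp (2 * Real.exp K) * Real.exp K) := by
    rw [momentConst]
    field_simp
    norm_num
  have hexp : 1 ≤ Real.exp (2 * Real.exp K) * Real.exp K := one_le_mul_of_one_le_of_one_le
    (Real.one_le_exp (by positivity)) (Real.one_le_exp hK.le)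
  linarith

namespace IsLDAModel

theorem integral_exp_mul_abs_mul_le (hP : IsLDAModel P M SW) {K : ℝ} {u v : Fin p → ℝ}
    (hum : ∀ ℓ, |∑ j, u j * M j ℓ| ≤ K) (huu : u ⬝ᵥ (SW *ᵥ u) ≤ K)
    (hvm : ∀ ℓ, |∑ j, v j * M j ℓ| ≤ K) (hvv : v ⬝ᵥ (SW *ᵥ v) ≤ K) {l : ℝ} (hl : 0 < l)
    (hlK : 8 * l * K ≤ 1) :
    Integrable (fun z => Real.exp (l * |(∑ j, u j * z.1 j) * ∑ j, v j * z.1 j|)) P ∧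
      ∫ z, Real.exp (l * |(∑ j, u j * z.1 j) * ∑ j, v j * z.1 j|) ∂P ≤ 2 * Real.exp K := by
  have hclass := fun ℓ => integral_exp_mul_abs_mul_multivariateGaussian_le
    (WithLp.toLp 2 fun j => M j ℓ) hP.posDef.posSemidef (hum ℓ) huu (hvm ℓ) hvv hl hlK
  obtain ⟨hint, hmix⟩ := hP.integral_eq_sum
    (f := fun z => Real.exp (l * |(∑ j, u j * z.1 j) * ∑ j, v j * z.1 j|)) (by fun_prop)
    fun ℓ => (hclass ℓ).1
  refine ⟨hint, ?_⟩
  calc _ ≤ ∑ ℓ, classProb P ℓ * (2 * Real.exp K) := hmix.trans_le <|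
        Finset.sum_le_sum fun ℓ _ =>
          mul_le_mul_of_nonneg_left (hclass ℓ).2 (hP.classProb_pos ℓ).le
    _ = 2 * Real.exp K := by rw [← Finset.sum_mul, hP.sum_classProb, one_mul]

theorem measureReal_moment_deviation_le (hP : IsLDAModel P M SW) (hn : 0 < n)
    (hD : ∀ i, HasLaw (D i) P μ) (hind : iIndepFun D μ) {K : ℝ} (hK : 0 < K) {u v : Fin p → ℝ}
    (hum : ∀ ℓ, |∑ j, u j * M j ℓ| ≤ K) (huu : u ⬝ᵥ (SW *ᵥ u) ≤ K)
    (hvm : ∀ ℓ, |∑ j, v j * M j ℓ| ≤ K) (hvv : v ⬝ᵥ (SW *ᵥ v) ≤ K)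
    {s : ℝ} (hs : 0 ≤ s) (hsn : s ≤ n) :
    μ.real {ω | 2 * √(s * (n * momentConst K)) <
      |∑ i, ((∑ j, u j * (D i ω).1 j) * (∑ j, v j * (D i ω).1 j) -
        ∫ z, (∑ j, u j * z.1 j) * (∑ j, v j * z.1 j) ∂P)|} ≤ 2 * Real.exp (-s) := by
  have := hP.isProbabilityMeasure
  have hl : 0 < 1 / (8 * K) := by positivity
  have hlK : 8 * (1 / (8 * K)) * K ≤ 1 := by field_simp; exact le_rfl
  have hZ : Measurable fun z : Obs p L => (∑ j, u j * z.1 j) * ∑ j, v j * z.1 j := by fun_prop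
  obtain ⟨hint, hle⟩ := hP.integral_exp_mul_abs_mul_le hum huu hvm hvv hl hlK
  refine measureReal_lt_abs_sum_le hn hD hind
    (f := fun z => (∑ j, u j * z.1 j) * (∑ j, v j * z.1 j) -
        ∫ z, (∑ j, u j * z.1 j) * (∑ j, v j * z.1 j) ∂P)
    (hZ.sub_const _) (momentConst_pos hK) (t₀ := 1 / (8 * K) / 2) (by positivity)
    (fun t ht => integral_exp_mul_sub_le hZ hl hint hle ht) hs ?_
  rw [mul_assoc]
  exact hsn.trans (le_mul_of_one_le_right (Nat.cast_nonneg n) (one_le_momentConst_mul_sq hK))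

-- Subtracting `t² K / 2` only on the class `ℓ` makes the exponential moment at most one whatever
-- the class probability, which is what makes the resulting deviation bound self-normalised.
theorem integral_exp_oneHot_mul_le (hP : IsLDAModel P M SW) (ℓ : Fin L) {v : Fin p → ℝ} {K : ℝ}
    (hv : v ⬝ᵥ (SW *ᵥ v) ≤ K) (t : ℝ) :
    Integrable (fun z => Real.exp
        (oneHot z.2 ℓ * (t * (∑ j, v j * (z.1 j - M j ℓ)) - t ^ 2 * K / 2))) P ∧
      ∫ z, Real.exp (oneHot z.2 ℓ * (t * (∑ j, v j * (z.1 j - M j ℓ)) - t ^ 2 * K / 2)) ∂P ≤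
        1 := by
  set f : Obs p L → ℝ := fun z =>
    oneHot z.2 ℓ * (t * (∑ j, v j * (z.1 j - M j ℓ)) - t ^ 2 * K / 2) with hf
  have hclass : ∀ k, Integrable (fun x => Real.exp (f (x, k)))
        (multivariateGaussian (WithLp.toLp 2 (fun j => M j k)) SW) ∧
      ∫ x, Real.exp (f (x, k))
        ∂(multivariateGaussian (WithLp.toLp 2 (fun j => M j k)) SW) ≤ 1 := by
    intro k
    by_cases hk : k = ℓ
    · subst hk
      obtain ⟨hint, hmgf⟩ := integral_exp_mul_sub_multivariateGaussian
        (WithLp.toLp 2 (fun j => M j k)) hP.posDef.posSemidef v t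
      have hfun : (fun x : EuclideanSpace ℝ (Fin p) => Real.exp (f (x, k))) = fun x =>
          Real.exp (t * ∑ j, v j * (x j - M j k)) * Real.exp (-(t ^ 2 * K / 2)) := by
        ext x
        rw [← Real.exp_add]
        simp [hf, oneHot, sub_eq_add_neg]
      rw [hfun]
      refine ⟨hint.mul_const _, ?_⟩
      rw [integral_mul_const]
      refine (congrArg (· * Real.exp (-(t ^ 2 * K / 2))) hmgf).trans_le ?_
      simp only [← Real.exp_add]
      rw [Real.exp_le_one_iff]
      nlinarith [sq_nonneg t]
    · have hfun : (fun x : EuclideanSpace ℝ (Fin p) => Real.exp (f (x, k))) = fun _ => 1 := by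
        ext x
        simp [hf, oneHot, hk]
      rw [hfun]
      exact ⟨integrable_const _, by simp⟩
  have hmeas : Measurable f := (measurable_oneHot ℓ).mul (by fun_prop)
  obtain ⟨hint, hmix⟩ := hP.integral_eq_sum (f := fun z => Real.exp (f z)) hmeas.exp
    fun k => (hclass k).1
  refine ⟨hint, hmix.trans_le ?_⟩
  rw [← hP.sum_classProb]
  exact Finset.sum_le_sum fun k _ => mul_le_of_le_one_right (hP.classProb_pos k).le (hclass k).2

theorem measureReal_centredClassSum_ge_le (hP : IsLDAModel P M SW) (hD : ∀ i, HasLaw (D i) P μ)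
    (hind : iIndepFun D μ) (ℓ : Fin L) {v : Fin p → ℝ} {K : ℝ} (hv : v ⬝ᵥ (SW *ᵥ v) ≤ K)
    (t s : ℝ) :
    μ.real {ω | s + t ^ 2 * K / 2 * classCount (fun i => D i ω) ℓ ≤
      t * centredClassSum M (fun i => D i ω) v ℓ} ≤ Real.exp (-s) := by
  have := hP.isProbabilityMeasure
  obtain ⟨hint, hle⟩ := hP.integral_exp_oneHot_mul_le ℓ hv t
  have hchernoff := measureReal_le_sum_le_exp hD hind
    ((measurable_oneHot ℓ).mul (by fun_prop)) hint (hle.trans_eq Real.exp_zero.symm) s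
  rw [mul_zero, zero_sub] at hchernoff
  convert hchernoff using 4 with ω
  rw [classCount, centredClassSum, Finset.mul_sum, Finset.mul_sum, ← le_sub_iff_add_le,
    ← Finset.sum_sub_distrib]
  refine iff_of_eq (congrArg _ (Finset.sum_congr rfl fun i _ => ?_))
  simp only [Pi.mul_apply]
  ring

end IsLDAModel

theorem add_le_mul_abs_of_lt_abs_div {W N a K s : ℝ} (ha : 0 < a) (hK : 0 < K) (hs : 0 < s)
    (hNa : |N - a| ≤ a / 2) (h : 4 * √(s * K / a) < |W / N|) :
    s + √(s / (a * K)) ^ 2 * K / 2 * N ≤ √(s / (a * K)) * |W| := by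
  obtain ⟨hlower, hupper⟩ := abs_le.1 hNa
  have hN : 0 < N := by linarith
  set t := √(s / (a * K)) with ht
  have htsq : t ^ 2 = s / (a * K) := Real.sq_sqrt (by positivity)
  have htmul : t * √(s * K / a) = s / a := by
    rw [ht, ← Real.sqrt_mul (by positivity), ← Real.sqrt_sq (by positivity : 0 ≤ s / a)]
    congr 1
    field_simp
  rw [abs_div, abs_of_pos hN, lt_div_iff₀ hN] at h
  calc s + t ^ 2 * K / 2 * N ≤ s + t ^ 2 * K / 2 * (2 * a) := by gcongr; linarith
    _ = 4 * (s / a) * (a / 2) := by rw [htsq]; field_simp; norm_num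
    _ ≤ 4 * (s / a) * N := by gcongr; linarith
    _ = t * (4 * √(s * K / a) * N) := by rw [← htmul]; ring
    _ ≤ t * |W| := by gcongr

theorem IsLDAModel.measureReal_meanEst_deviation_le (hP : IsLDAModel P M SW) (hn : 0 < n)
    (hD : ∀ i, HasLaw (D i) P μ) (hind : iIndepFun D μ) (ℓ : Fin L) {v : Fin p → ℝ} {K : ℝ}
    (hK : 0 < K) (hv : v ⬝ᵥ (SW *ᵥ v) ≤ K) {s : ℝ} (hs : 0 < s) :
    μ.real {ω | (∀ k, |classCount (fun i => D i ω) k - n * classProb P k| ≤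
        n * classProb P k / 2) ∧
      4 * √(s * K / (n * classProb P ℓ)) <
        |∑ j, v j * (meanEst (fun i => D i ω) j ℓ - M j ℓ)|} ≤ 2 * Real.exp (-s) := by
  have := hind.isProbabilityMeasure
  have hpos : ∀ k, 0 < n * classProb P k := fun k =>
    mul_pos (Nat.cast_pos.2 hn) (hP.classProb_pos k)
  set t := √(s / (n * classProb P ℓ * K))
  have htail := fun r => hP.measureReal_centredClassSum_ge_le hD hind ℓ hv r s
  calc _ ≤ _ := measureReal_mono fun ω hω => ?_
    _ ≤ _ := measureReal_union_le _ _
    _ ≤ Real.exp (-s) + Real.exp (-s) := add_le_add (htail t) (htail (-t))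
    _ = _ := (two_mul _).symm
  obtain ⟨hcount, hdev⟩ := hω
  have hne : ∀ k, classCount (fun i => D i ω) k ≠ 0 := fun k => by
    have := (abs_le.1 (hcount k)).1
    exact ne_of_gt (by linarith [hpos k])
  rw [sum_mul_meanEst_sub hne] at hdev
  have hsum := add_le_mul_abs_of_lt_abs_div (hpos ℓ) hK hs (hcount ℓ) hdev
  rw [← abs_of_nonneg (Real.sqrt_nonneg (s / (n * classProb P ℓ * K))), ← abs_mul,
    abs_of_nonneg (Real.sqrt_nonneg _)] at hsum
  simp only [Set.mem_union, Set.mem_ofPred_eq, neg_sq, neg_mul]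
  exact le_abs.1 hsum

end Deviations

/-! ### Typical samples -/

section TypicalSamples

variable {n p L : ℕ} {K : ℝ} {P : Measure (Obs p L)} {M : Matrix (Fin p) (Fin L) ℝ}
  {SW : Matrix (Fin p) (Fin p) ℝ}

theorem IsLDAModel.card_pos (hP : IsLDAModel P M SW) : 0 < L := by
  by_contra! hL
  obtain rfl := Nat.le_zero.1 hL
  simpa using hP.sum_classProb

/-- An LDA model whose class probabilities are of order `1 / L`, whose discriminant scores are
bounded in mean and variance and whose features have bounded within-class variances. The single
constant `K` stands for all the absolute constants of the assumptions. -/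
structure IsBalancedLDAModel (K : ℝ) (P : Measure (Obs p L)) (M : Matrix (Fin p) (Fin L) ℝ)
    (SW : Matrix (Fin p) (Fin p) ℝ) : Prop extends IsLDAModel P M SW where
  one_le : 1 ≤ K
  classProb_inv_le : ∀ ℓ, (classProb P ℓ)⁻¹ ≤ K * L
  classProb_le : ∀ ℓ, classProb P ℓ ≤ K / L
  discGram_le : ∀ k ℓ, |discGram SW M k ℓ| ≤ K
  variance_le : ∀ j, SW j j ≤ K

/-- The class counts, the sample second moments of the discriminant scores and the class means
along the discriminant directions deviate from their population values by no more than their tail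
bounds allow at probability of order `n⁻⁶`, and the coordinates of the class means by no more than
at probability of order `(n ∨ p)⁻⁶`. -/
structure IsTypicalSample (K : ℝ) (P : Measure (Obs p L)) (M : Matrix (Fin p) (Fin L) ℝ)
    (SW : Matrix (Fin p) (Fin p) ℝ) (D : Fin n → Obs p L) : Prop where
  classCount_le : ∀ ℓ, |classCount D ℓ - n * classProb P ℓ| ≤
    2 * √(6 * Real.log n * (n * classProb P ℓ))
  moment_le : ∀ k ℓ, |∑ i, ((∑ j, discB SW M j k * (D i).1 j) * (∑ j, discB SW M j ℓ * (D i).1 j) -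
      ∫ z, (∑ j, discB SW M j k * z.1 j) * (∑ j, discB SW M j ℓ * z.1 j) ∂P)| ≤
    2 * √(6 * Real.log n * (n * momentConst K))
  score_le : ∀ k ℓ, |∑ j, discB SW M j k * (meanEst D j ℓ - M j ℓ)| ≤
    4 * √(6 * Real.log n * K / (n * classProb P ℓ))
  mean_le : ∀ j ℓ, |meanEst D j ℓ - M j ℓ| ≤
    4 * √(6 * Real.log (max (n : ℝ) p) * K / (n * classProb P ℓ))

theorem one_le_log_of_three_le (hn : 3 ≤ n) : 1 ≤ Real.log n := by
  have hn3 : (3 : ℝ) ≤ n := mod_cast hn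
  rw [Real.le_log_iff_exp_le (by linarith)]
  linarith [Real.exp_one_lt_d9]

theorem measureReal_iUnion_le_two_div_pow {Ω ι : Type*} [MeasurableSpace Ω] {μ : Measure Ω}
    [Fintype ι] {A : ι → Set Ω} {x : ℝ} (hx : 0 < x) (hcard : (Fintype.card ι : ℝ) ≤ x * x)
    (hA : ∀ i, μ.real (A i) ≤ 2 * Real.exp (-(6 * Real.log x))) :
    μ.real (⋃ i, A i) ≤ 2 / x ^ 4 := by
  have hexp : Real.exp (-(6 * Real.log x)) = (x ^ 6)⁻¹ := by
    rw [Real.exp_neg, ← Real.exp_log (pow_pos hx 6), Real.log_pow]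
    norm_num
  calc _ ≤ ∑ i, μ.real (A i) := measureReal_iUnion_fintype_le _
    _ ≤ ∑ _i : ι, 2 * Real.exp (-(6 * Real.log x)) := Finset.sum_le_sum fun i _ => hA i
    _ = Fintype.card ι * (2 * (x ^ 6)⁻¹) := by
        rw [hexp, Finset.sum_const, Finset.card_univ, nsmul_eq_mul]
    _ ≤ x * x * (2 * (x ^ 6)⁻¹) := by gcongr
    _ = 2 / x ^ 4 := by field_simp

theorem two_mul_sqrt_six_mul_le {l a : ℝ} (ha : 0 ≤ a) (hla : 96 * l ≤ a) :
    2 * √(6 * l * a) ≤ a / 2 := by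
  have hsqrt : √(6 * l * a) ≤ a / 4 := Real.sqrt_le_iff.2 ⟨by positivity, by nlinarith⟩
  linarith

namespace IsBalancedLDAModel

theorem mono (h : IsBalancedLDAModel K P M SW) {K' : ℝ} (hK : K ≤ K') :
    IsBalancedLDAModel K' P M SW where
  toIsLDAModel := h.toIsLDAModel
  one_le := h.one_le.trans hK
  classProb_inv_le ℓ := (h.classProb_inv_le ℓ).trans (by gcongr)
  classProb_le ℓ := (h.classProb_le ℓ).trans (by gcongr)
  discGram_le k ℓ := (h.discGram_le k ℓ).trans hK
  variance_le j := (h.variance_le j).trans hK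

theorem le_mul_classProb (h : IsBalancedLDAModel K P M SW) (hn : 3 ≤ n)
    (hlog : 96 * K * (L * Real.log n) ≤ n) (ℓ : Fin L) :
    96 * Real.log n ≤ n * classProb P ℓ := by
  have hlog_pos := one_le_log_of_three_le hn
  have hweight : 1 ≤ classProb P ℓ * (K * L) :=
    (inv_le_iff_one_le_mul₀' (h.classProb_pos ℓ)).1 (h.classProb_inv_le ℓ)
  calc 96 * Real.log n ≤ 96 * Real.log n * (classProb P ℓ * (K * L)) :=
        le_mul_of_one_le_right (by positivity) hweight
    _ = 96 * K * (L * Real.log n) * classProb P ℓ := by ring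
    _ ≤ n * classProb P ℓ := mul_le_mul_of_nonneg_right hlog (h.classProb_pos ℓ).le

theorem card_le (h : IsBalancedLDAModel K P M SW) (hn : 3 ≤ n)
    (hlog : 96 * K * (L * Real.log n) ≤ n) : (L : ℝ) ≤ n := by
  have hK : 1 ≤ 96 * K := by linarith [h.one_le]
  calc (L : ℝ) ≤ L * Real.log n :=
        le_mul_of_one_le_right (Nat.cast_nonneg L) (one_le_log_of_three_le hn)
    _ ≤ 96 * K * (L * Real.log n) := le_mul_of_one_le_left (by positivity) hK
    _ ≤ n := hlog

section Probability

variable {Ω : Type*} [MeasurableSpace Ω] {μ : Measure Ω} {D : Fin n → Ω → Obs p L}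

theorem measureReal_classCount_deviations_le (h : IsBalancedLDAModel K P M SW) (hn : 3 ≤ n)
    (hD : ∀ i, HasLaw (D i) P μ) (hind : iIndepFun D μ)
    (hlog : 96 * K * (L * Real.log n) ≤ n) :
    μ.real (⋃ ℓ, {ω | 2 * √(6 * Real.log n * (n * classProb P ℓ)) <
      |classCount (fun i => D i ω) ℓ - n * classProb P ℓ|}) ≤ 2 / (n : ℝ) ^ 4 := by
  have hlog_ge := one_le_log_of_three_le hn
  refine measureReal_iUnion_le_two_div_pow (by positivity) ?_ fun ℓ => ?_
  · rw [Fintype.card_fin]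
    exact (h.card_le hn hlog).trans (le_mul_of_one_le_left (by positivity) (by norm_cast; omega))
  · exact h.measureReal_classCount_deviation_le (by omega) hD hind ℓ (by positivity)
      (by linarith [h.le_mul_classProb hn hlog ℓ])

theorem discB_dotProduct_mulVec_le (h : IsBalancedLDAModel K P M SW) (k : Fin L) :
    (fun j => discB SW M j k) ⬝ᵥ (SW *ᵥ fun j => discB SW M j k) ≤ K := by
  rw [discB_dotProduct_mulVec h.posDef]
  exact (le_abs_self _).trans (h.discGram_le k k)

theorem measureReal_moment_deviations_le (h : IsBalancedLDAModel K P M SW) (hn : 3 ≤ n)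
    (hD : ∀ i, HasLaw (D i) P μ) (hind : iIndepFun D μ)
    (hlog : 96 * K * (L * Real.log n) ≤ n) :
    μ.real (⋃ q : Fin L × Fin L, {ω | 2 * √(6 * Real.log n * (n * momentConst K)) <
      |∑ i, ((∑ j, discB SW M j q.1 * (D i ω).1 j) * (∑ j, discB SW M j q.2 * (D i ω).1 j) -
        ∫ z, (∑ j, discB SW M j q.1 * z.1 j) * (∑ j, discB SW M j q.2 * z.1 j) ∂P)|}) ≤
      2 / (n : ℝ) ^ 4 := by
  have hlog_ge := one_le_log_of_three_le hn
  have hL : (1 : ℝ) ≤ L := mod_cast h.card_pos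
  have hLn := h.card_le hn hlog
  have hmean : ∀ k ℓ, |∑ j, discB SW M j k * M j ℓ| ≤ K := fun k ℓ => by
    rw [sum_discB_mul h.posDef]
    exact h.discGram_le k ℓ
  refine measureReal_iUnion_le_two_div_pow (by positivity) ?_ fun q => ?_
  · rw [Fintype.card_prod, Fintype.card_fin, Nat.cast_mul]
    gcongr
  · exact h.measureReal_moment_deviation_le (by omega) hD hind (zero_lt_one.trans_le h.one_le)
      (hmean q.1) (h.discB_dotProduct_mulVec_le q.1) (hmean q.2) (h.discB_dotProduct_mulVec_le q.2)
      (by positivity)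
      (by nlinarith [mul_le_mul h.one_le hL zero_le_one (zero_le_one.trans h.one_le)])

theorem measureReal_score_deviations_le (h : IsBalancedLDAModel K P M SW) (hn : 3 ≤ n)
    (hD : ∀ i, HasLaw (D i) P μ) (hind : iIndepFun D μ)
    (hlog : 96 * K * (L * Real.log n) ≤ n) :
    μ.real (⋃ q : Fin L × Fin L, {ω |
      (∀ k, |classCount (fun i => D i ω) k - n * classProb P k| ≤ n * classProb P k / 2) ∧
        4 * √(6 * Real.log n * K / (n * classProb P q.2)) <
          |∑ j, discB SW M j q.1 * (meanEst (fun i => D i ω) j q.2 - M j q.2)|}) ≤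
      2 / (n : ℝ) ^ 4 := by
  have hlog_ge := one_le_log_of_three_le hn
  have hLn := h.card_le hn hlog
  refine measureReal_iUnion_le_two_div_pow (by positivity) ?_ fun q => ?_
  · rw [Fintype.card_prod, Fintype.card_fin, Nat.cast_mul]
    gcongr
  · exact h.measureReal_meanEst_deviation_le (by omega) hD hind q.2
      (zero_lt_one.trans_le h.one_le) (h.discB_dotProduct_mulVec_le q.1) (by positivity)

theorem measureReal_mean_deviations_le (h : IsBalancedLDAModel K P M SW) (hn : 3 ≤ n)
    (hD : ∀ i, HasLaw (D i) P μ) (hind : iIndepFun D μ)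
    (hlog : 96 * K * (L * Real.log n) ≤ n) :
    μ.real (⋃ q : Fin p × Fin L, {ω |
      (∀ k, |classCount (fun i => D i ω) k - n * classProb P k| ≤ n * classProb P k / 2) ∧
        4 * √(6 * Real.log (max (n : ℝ) p) * K / (n * classProb P q.2)) <
          |meanEst (fun i => D i ω) q.1 q.2 - M q.1 q.2|}) ≤ 2 / (n : ℝ) ^ 4 := by
  have hn0 : (0 : ℝ) < n := by positivity
  have hmax : (n : ℝ) ≤ max (n : ℝ) p := le_max_left _ _
  have hLmax := (h.card_le hn hlog).trans hmax
  have hlog_pos : 0 < Real.log (max (n : ℝ) p) :=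
    (zero_lt_one.trans_le (one_le_log_of_three_le hn)).trans_le (Real.log_le_log hn0 hmax)
  have hcoord : ∀ (q : Fin p × Fin L) (ω : Ω),
      meanEst (fun i => D i ω) q.1 q.2 - M q.1 q.2 = ∑ j, (Pi.single q.1 1 : Fin p → ℝ) j *
        (meanEst (fun i => D i ω) j q.2 - M j q.2) := fun q ω => by
    simp [Pi.single_apply]
  simp only [hcoord]
  refine (measureReal_iUnion_le_two_div_pow (hn0.trans_le hmax) ?_ fun q => ?_).trans (by gcongr)
  · rw [Fintype.card_prod, Fintype.card_fin, Fintype.card_fin, Nat.cast_mul]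
    gcongr
    exact le_max_right _ _
  · exact h.measureReal_meanEst_deviation_le (by omega) hD hind q.2 (zero_lt_one.trans_le h.one_le)
      (by simpa using h.variance_le q.1) (mul_pos (by norm_num) hlog_pos)

theorem measureReal_not_isTypicalSample_le (h : IsBalancedLDAModel K P M SW) (hn : 3 ≤ n)
    (hD : ∀ i, HasLaw (D i) P μ) (hind : iIndepFun D μ)
    (hlog : 96 * K * (L * Real.log n) ≤ n) :
    μ.real {ω | ¬ IsTypicalSample K P M SW fun i => D i ω} ≤ 1 / n := by
  have := hind.isProbabilityMeasure
  have hn3 : (3 : ℝ) ≤ n := mod_cast hn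
  have hhalf : ∀ ℓ, 2 * √(6 * Real.log n * (n * classProb P ℓ)) ≤ n * classProb P ℓ / 2 :=
    fun ℓ => two_mul_sqrt_six_mul_le (mul_pos (by positivity) (h.classProb_pos ℓ)).le
      (h.le_mul_classProb hn hlog ℓ)
  have hunion := (measureReal_union_le _ _).trans (add_le_add
    ((measureReal_union_le _ _).trans (add_le_add
      (h.measureReal_classCount_deviations_le hn hD hind hlog)
      (h.measureReal_moment_deviations_le hn hD hind hlog)))
    ((measureReal_union_le _ _).trans (add_le_add
      (h.measureReal_score_deviations_le hn hD hind hlog)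
      (h.measureReal_mean_deviations_le hn hD hind hlog))))
  refine (measureReal_mono fun ω hω => ?_).trans (hunion.trans ?_)
  · contrapose! hω
    simp only [Set.mem_union, Set.mem_iUnion, Set.mem_ofPred_eq, not_or, not_exists, not_and,
      not_lt] at hω
    obtain ⟨⟨hcount, hmoment⟩, hscore, hmean⟩ := hω
    have hcount_half := fun ℓ => (hcount ℓ).trans (hhalf ℓ)
    exact not_not.2 ⟨hcount, fun k ℓ => hmoment (k, ℓ), fun k ℓ => hscore (k, ℓ) hcount_half,
      fun j ℓ => hmean (j, ℓ) hcount_half⟩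
  · have hcube : (3 : ℝ) ^ 3 ≤ n ^ 3 := by gcongr
    calc _ = 8 / (n : ℝ) ^ 4 := by ring
      _ ≤ 1 / n := by
        rw [div_le_div_iff₀ (by positivity) (by positivity)]
        nlinarith

end Probability

end IsBalancedLDAModel

/-- The constant that bounds the deviations of a typical sample from a balanced model, relative to
the rates `√(L log n / n)` and `√(L log (n ∨ p) / n)`. -/
noncomputable def sampleConst (K : ℝ) : ℝ := 10 * K + 2 * √(6 * momentConst K)

theorem le_sampleConst (K : ℝ) : 10 * K ≤ sampleConst K :=
  le_add_of_nonneg_right (by positivity)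

theorem IsBalancedLDAModel.four_mul_sqrt_le (h : IsBalancedLDAModel K P M SW) (n : ℕ) (ℓ : Fin L)
    {l : ℝ} (hl : 0 ≤ l) :
    4 * √(6 * l * K / (n * classProb P ℓ)) ≤ sampleConst K * √(L * l / n) := by
  have hK := h.one_le
  have hle : 6 * l * K / (n * classProb P ℓ) ≤ 6 * K ^ 2 * (L * l / n) := by
    calc 6 * l * K / (n * classProb P ℓ) = 6 * l * K / n * (classProb P ℓ)⁻¹ := by
          rw [← div_div, div_eq_mul_inv _ (classProb P ℓ)]
      _ ≤ 6 * l * K / n * (K * L) := by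
          gcongr
          exact h.classProb_inv_le ℓ
      _ = _ := by ring
  have hsqrt : √(6 * l * K / (n * classProb P ℓ)) ≤ 5 / 2 * K * √(L * l / n) := by
    refine Real.sqrt_le_iff.2 ⟨by positivity, hle.trans ?_⟩
    rw [mul_pow, Real.sq_sqrt (by positivity)]
    have : 0 ≤ K ^ 2 * (L * l / n) := by positivity
    nlinarith
  calc _ ≤ 4 * (5 / 2 * K * √(L * l / n)) := by gcongr
    _ = 10 * K * √(L * l / n) := by ring
    _ ≤ _ := by
        gcongr
        exact le_sampleConst K

namespace IsTypicalSample

variable {D : Fin n → Obs p L}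

theorem abs_frequency_sub_le (hD : IsTypicalSample K P M SW D) (h : IsBalancedLDAModel K P M SW)
    (hn : 3 ≤ n) (ℓ : Fin L) :
    |classCount D ℓ / n - classProb P ℓ| ≤ sampleConst K * √(L * Real.log n / n) / L := by
  have hn0 : (0 : ℝ) < n := by positivity
  have hL : (0 : ℝ) < L := mod_cast h.card_pos
  have hK := h.one_le
  have hlog := one_le_log_of_three_le hn
  have hsqrt : √(6 * Real.log n * (n * classProb P ℓ)) ≤
      5 * K * √(L * Real.log n / n) / L * n := by
    refine Real.sqrt_le_iff.2 ⟨by positivity, ?_⟩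
    calc 6 * Real.log n * (n * classProb P ℓ) ≤ 6 * Real.log n * (n * (K / L)) := by
          gcongr
          exact h.classProb_le ℓ
      _ ≤ 25 * Real.log n * (n * (K ^ 2 / L)) := by
          gcongr
          · norm_num
          · nlinarith
      _ = (5 * K / L * n) ^ 2 * (L * Real.log n / n) := by field_simp; norm_num
      _ = (5 * K / L * n) ^ 2 * √(L * Real.log n / n) ^ 2 := by
          rw [Real.sq_sqrt (by positivity)]
      _ = _ := by ring
  rw [div_sub' hn0.ne', abs_div, abs_of_pos hn0, div_le_iff₀ hn0]
  calc _ ≤ 2 * √(6 * Real.log n * (n * classProb P ℓ)) := hD.classCount_le ℓ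
    _ ≤ 2 * (5 * K * √(L * Real.log n / n) / L * n) := by gcongr
    _ = 10 * K * √(L * Real.log n / n) / L * n := by ring
    _ ≤ _ := by
        gcongr
        exact le_sampleConst K

theorem abs_momentPerturbation_le (hD : IsTypicalSample K P M SW D)
    (h : IsBalancedLDAModel K P M SW) (hn : 3 ≤ n) (k ℓ : Fin L) :
    |momentPerturbation (classProb P) (discGram SW M) (scaledFeat D * discB SW M) k ℓ| ≤
      sampleConst K * √(L * Real.log n / n) / √L := by
  have hn0 : (0 : ℝ) < n := by positivity
  have hL : (0 : ℝ) < L := mod_cast h.card_pos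
  have hK := zero_lt_one.trans_le h.one_le
  have hconst := momentConst_pos hK
  have hlog := one_le_log_of_three_le hn
  have hmoment := hD.moment_le k ℓ
  rw [Finset.sum_sub_distrib, Finset.sum_const, Finset.card_univ, Fintype.card_fin,
    nsmul_eq_mul] at hmoment
  have hsqrt : √(6 * Real.log n * (n * momentConst K)) =
      √(6 * momentConst K) * (√(L * Real.log n / n) / √L) * n := by
    have hfactor : 6 * Real.log n * (n * momentConst K) =
        6 * momentConst K * (L * Real.log n / n / L) * (n : ℝ) ^ 2 := by field_simp
    rw [hfactor, Real.sqrt_mul (by positivity), Real.sqrt_sq hn0.le, Real.sqrt_mul (by positivity),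
      Real.sqrt_div (by positivity)]
  rw [momentPerturbation, Matrix.sub_apply, scaledFeat_mul_gram_apply, ← h.integral_discB_mul,
    div_sub' hn0.ne', abs_div, abs_of_pos hn0, div_le_iff₀ hn0]
  calc _ ≤ 2 * √(6 * Real.log n * (n * momentConst K)) := hmoment
    _ = 2 * √(6 * momentConst K) * √(L * Real.log n / n) / √L * n := by rw [hsqrt]; ring
    _ ≤ _ := by
        gcongr
        rw [sampleConst]
        linarith

theorem abs_sum_discB_mul_meanEst_sub_le (hD : IsTypicalSample K P M SW D)
    (h : IsBalancedLDAModel K P M SW) (k ℓ : Fin L) :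
    |∑ j, discB SW M j k * (meanEst D j ℓ - M j ℓ)| ≤ sampleConst K * √(L * Real.log n / n) :=
  (hD.score_le k ℓ).trans (h.four_mul_sqrt_le n ℓ (Real.log_natCast_nonneg n))

theorem abs_meanEst_sub_le (hD : IsTypicalSample K P M SW D) (h : IsBalancedLDAModel K P M SW)
    (hn : 3 ≤ n) (j : Fin p) (ℓ : Fin L) :
    |meanEst D j ℓ - M j ℓ| ≤ sampleConst K * √(L * Real.log (max (n : ℝ) p) / n) :=
  (hD.mean_le j ℓ).trans <| h.four_mul_sqrt_le n ℓ <|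
    Real.log_nonneg (le_max_of_le_left (by norm_cast; omega))

end IsTypicalSample

end TypicalSamples

/-! ### The plug-in estimator -/

section PlugInEstimator

variable {n p L : ℕ} {K δ ω₁ ω₂ : ℝ} {P : Measure (Obs p L)} {M : Matrix (Fin p) (Fin L) ℝ}
  {SW : Matrix (Fin p) (Fin p) ℝ} {D : Fin n → Obs p L} {A : Matrix (Fin p) (Fin L) ℝ}

theorem pinv_eq_nonsing_inv {ι : Type*} [Fintype ι] [DecidableEq ι] {A : Matrix ι ι ℝ}
    (hA : IsUnit A) : pinv A = A⁻¹ := by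
  have hdet := (isUnit_iff_isUnit_det A).1 hA
  refine (pinv_spec A).unique ⟨?_, ?_, ?_, ?_⟩
  · rw [mul_nonsing_inv _ hdet, one_mul]
  · rw [nonsing_inv_mul _ hdet, one_mul]
  · rw [mul_nonsing_inv _ hdet, transpose_one]
  · rw [nonsing_inv_mul _ hdet, transpose_one]

/-- The perturbed regression behind the plug-in estimator based on the estimate `A` of `B`: the
class frequencies perturb the class probabilities, the sample scores stand for the population
scores, and the fitting error is that of `A`. -/
abbrev IsPerturbedFit (K δ ω : ℝ) (P : Measure (Obs p L)) (M : Matrix (Fin p) (Fin L) ℝ)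
    (SW : Matrix (Fin p) (Fin p) ℝ) (D : Fin n → Obs p L) (A : Matrix (Fin p) (Fin L) ℝ) : Prop :=
  PerturbedRegression K (√L) δ ω (classProb P) (fun ℓ => classCount D ℓ / n) (discGram SW M)
    (scaledFeat D * discB SW M) (scaledFeat D * (A - regB P))

namespace IsLDAModel

theorem discB_mul_residualCov_add (hP : IsLDAModel P M SW) (A : Matrix (Fin p) (Fin L) ℝ) :
    discB SW M * residualCov (classProb P) (discGram SW M) + (A - regB P) = A := by
  rw [← hP.regB_eq, add_sub_cancel]

theorem plugH_eq_residualGram (hP : IsLDAModel P M SW) (D : Fin n → Obs p L)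
    (A : Matrix (Fin p) (Fin L) ℝ) :
    plugH D A = residualGram (fun ℓ => classCount D ℓ / n)
      (scaledFeat D * discB SW M * residualCov (classProb P) (discGram SW M) +
        scaledFeat D * (A - regB P)) := by
  rw [Matrix.mul_assoc, ← Matrix.mul_add, hP.discB_mul_residualCov_add, plugH_eq]

theorem isUnit_plugH (hP : IsLDAModel P M SW) (h : IsPerturbedFit K δ ω₂ P M SW D A) :
    IsUnit (plugH D A) := by
  rw [hP.plugH_eq_residualGram]
  exact h.isUnit_residualGram

theorem discEst_eq (hP : IsLDAModel P M SW) (h : IsPerturbedFit K δ ω₂ P M SW D A) :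
    discEst D A = (discB SW M * residualCov (classProb P) (discGram SW M) + (A - regB P)) *
      (residualGram (fun ℓ => classCount D ℓ / n)
        (scaledFeat D * discB SW M * residualCov (classProb P) (discGram SW M) +
          scaledFeat D * (A - regB P)))⁻¹ := by
  rw [discEst, pinv_eq_nonsing_inv (hP.isUnit_plugH h), ← hP.plugH_eq_residualGram,
    hP.discB_mul_residualCov_add]

theorem frobNorm_discEst_sub_le (hP : IsLDAModel P M SW) (h : IsPerturbedFit K δ ω₂ P M SW D A)
    (hA : frobNorm (CFC.sqrt SW * (A - regB P)) ≤ ω₂) :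
    frobNorm (CFC.sqrt SW * (discEst D A - discB SW M)) ≤ 24 * K ^ 5 * L * (ω₂ + δ / √L) := by
  have hplugin := h.frobNorm_plugin_error_le (sqrt_mul_discB_transpose_mul_self hP.posDef M) hA
  rwa [Matrix.mul_assoc, ← Matrix.mul_add, Matrix.mul_assoc, ← hP.discEst_eq h, ← Matrix.mul_sub,
    Real.sq_sqrt L.cast_nonneg] at hplugin

theorem sum_sq_sum_mul_discEst_sub_le (hP : IsLDAModel P M SW)
    (h : IsPerturbedFit K δ ω₂ P M SW D A) {V : Matrix (Fin p) (Fin L) ℝ} {ρ : ℝ}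
    (hV : ∀ j ℓ, |V j ℓ| ≤ ρ) (hA : norm12 (A - regB P) ≤ ω₁)
    (hscore : ∀ k ℓ, |∑ j, discB SW M j k * V j ℓ| ≤ K * δ) :
    ∑ ℓ, (∑ j, V j ℓ * (discEst D A j ℓ - discB SW M j ℓ)) ^ 2 ≤
      32 * K ^ 2 * (ρ ^ 2 * ω₁ ^ 2 * L ^ 2) + 20 * K ^ 2 * (δ ^ 2 * L) := by
  have hplugin := h.sum_sq_sum_mul_plugin_error_le hV hA (β := discB SW M) hscore
  rwa [← hP.discEst_eq h, show √(L : ℝ) ^ 4 = (√(L : ℝ) ^ 2) ^ 2 by ring,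
    Real.sq_sqrt L.cast_nonneg] at hplugin

theorem sq_frobNorm_discEst_sub_mul_le (hP : IsLDAModel P M SW) {Δ : ℝ} (hn : 3 ≤ n)
    (h : IsPerturbedFit K (√(L * Real.log n / n)) ω₂ P M SW D A) (hΔ : Δ ≤ K)
    (hA : frobNorm (CFC.sqrt SW * (A - regB P)) ≤ ω₂) :
    frobNorm (CFC.sqrt SW * (discEst D A - discB SW M)) ^ 2 * (Δ + Real.log n) ≤
      2304 * K ^ 11 * ((L : ℝ) ^ 2 * Real.log n ^ 2 / n + ω₂ ^ 2 * (L : ℝ) ^ 2 * Real.log n) := by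
  have hK := h.one_le
  have hL : (0 : ℝ) < L := mod_cast hP.card_pos
  have hlog := one_le_log_of_three_le hn
  set s := √(L * Real.log n / n) / √L
  have hs : s ^ 2 = Real.log n / n := by
    rw [div_pow, Real.sq_sqrt (by positivity), Real.sq_sqrt hL.le]
    field_simp
  have herror : frobNorm (CFC.sqrt SW * (discEst D A - discB SW M)) ^ 2 ≤
      (24 * K ^ 5 * L) ^ 2 * (2 * (ω₂ ^ 2 + Real.log n / n)) := by
    refine (pow_le_pow_left₀ (frobNorm_nonneg _) (hP.frobNorm_discEst_sub_le h hA) 2).trans ?_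
    rw [mul_pow, ← hs]
    gcongr
    exact add_sq_le
  have hweight : Δ + Real.log n ≤ 2 * K * Real.log n := by nlinarith
  calc frobNorm (CFC.sqrt SW * (discEst D A - discB SW M)) ^ 2 * (Δ + Real.log n)
    _ ≤ frobNorm (CFC.sqrt SW * (discEst D A - discB SW M)) ^ 2 * (2 * K * Real.log n) := by gcongr
    _ ≤ (24 * K ^ 5 * L) ^ 2 * (2 * (ω₂ ^ 2 + Real.log n / n)) * (2 * K * Real.log n) := by gcongr
    _ = _ := by ring

theorem sum_sq_sum_meanEst_sub_mul_le (hP : IsLDAModel P M SW) (hn : 3 ≤ n)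
    (h : IsPerturbedFit K (√(L * Real.log n / n)) ω₂ P M SW D A)
    (hmean : ∀ j ℓ, |meanEst D j ℓ - M j ℓ| ≤ K * √(L * Real.log (max (n : ℝ) p) / n))
    (hscore : ∀ k ℓ, |∑ j, discB SW M j k * (meanEst D j ℓ - M j ℓ)| ≤
      K * √(L * Real.log n / n))
    (hA : norm12 (A - regB P) ≤ ω₁) :
    ∑ ℓ, (∑ j, (meanEst D j ℓ - M j ℓ) * (discEst D A j ℓ - discB SW M j ℓ)) ^ 2 ≤
      32 * K ^ 4 * (ω₁ ^ 2 * (L : ℝ) ^ 3 * Real.log (max (n : ℝ) p) / n) +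
        20 * K ^ 2 * ((L : ℝ) ^ 2 * Real.log n ^ 2 / n) := by
  have hlog := one_le_log_of_three_le hn
  have hlog_max : 0 ≤ Real.log (max (n : ℝ) p) :=
    Real.log_nonneg (le_max_of_le_left (by norm_cast; omega))
  have hlog_sq : Real.log n ≤ Real.log n ^ 2 := by nlinarith
  refine (hP.sum_sq_sum_mul_discEst_sub_le h (V := meanEst D - M) hmean hA hscore).trans ?_
  rw [mul_pow, Real.sq_sqrt (by positivity), Real.sq_sqrt (by positivity)]
  calc _ = 32 * K ^ 4 * (ω₁ ^ 2 * (L : ℝ) ^ 3 * Real.log (max (n : ℝ) p) / n) +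
        20 * K ^ 2 * ((L : ℝ) ^ 2 * Real.log n / n) := by ring
    _ ≤ _ := by gcongr

theorem errQ_discEst_le (hP : IsLDAModel P M SW) {Δ : ℝ} (hn : 3 ≤ n)
    (h : IsPerturbedFit K (√(L * Real.log n / n)) ω₂ P M SW D A) (hΔ : Δ ≤ K)
    (hmean : ∀ j ℓ, |meanEst D j ℓ - M j ℓ| ≤ K * √(L * Real.log (max (n : ℝ) p) / n))
    (hscore : ∀ k ℓ, |∑ j, discB SW M j k * (meanEst D j ℓ - M j ℓ)| ≤
      K * √(L * Real.log n / n))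
    (hA : ErrorBounds P SW ω₁ ω₂ D A) :
    errQ SW M Δ D (discEst D A) ≤
      2400 * K ^ 11 * ((L : ℝ) ^ 2 * Real.log n ^ 2 / n + ω₂ ^ 2 * (L : ℝ) ^ 2 * Real.log n +
        ω₁ ^ 2 * (L : ℝ) ^ 3 * Real.log (max (n : ℝ) p) / n) := by
  have hlog := one_le_log_of_three_le hn
  have hlog_max : 0 ≤ Real.log (max (n : ℝ) p) :=
    Real.log_nonneg (le_max_of_le_left (by norm_cast; omega))
  have hK := h.K_pos
  have hK4 : K ^ 4 ≤ K ^ 11 := pow_le_pow_right₀ h.one_le (by norm_num)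
  have hK2 : K ^ 2 ≤ K ^ 11 := pow_le_pow_right₀ h.one_le (by norm_num)
  set x := (L : ℝ) ^ 2 * Real.log n ^ 2 / n
  set y := ω₂ ^ 2 * (L : ℝ) ^ 2 * Real.log n
  set z := ω₁ ^ 2 * (L : ℝ) ^ 3 * Real.log (max (n : ℝ) p) / n
  have hx : 0 ≤ x := by positivity
  have hy : 0 ≤ y := by positivity
  have hz : 0 ≤ z := by positivity
  calc errQ SW M Δ D (discEst D A)
    _ ≤ 2304 * K ^ 11 * (x + y) + (32 * K ^ 4 * z + 20 * K ^ 2 * x) :=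
        add_le_add (hP.sq_frobNorm_discEst_sub_mul_le hn h hΔ ((le_max_right _ _).trans hA.1))
          (hP.sum_sq_sum_meanEst_sub_mul_le hn h hmean hscore hA.2)
    _ ≤ 2304 * K ^ 11 * (x + y) + (32 * K ^ 11 * z + 20 * K ^ 11 * x) := by gcongr
    _ = K ^ 11 * (2324 * x + 2304 * y + 32 * z) := by ring
    _ ≤ K ^ 11 * (2400 * (x + y + z)) := by
        gcongr
        linarith
    _ = _ := by ring

end IsLDAModel

theorem IsBalancedLDAModel.le_sampleConst_self (h : IsBalancedLDAModel K P M SW) :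
    K ≤ sampleConst K := by
  linarith [h.one_le, le_sampleConst K]

namespace IsTypicalSample

theorem isPerturbedFit (hD : IsTypicalSample K P M SW D) (h : IsBalancedLDAModel K P M SW)
    (hn : 3 ≤ n) (hδ : 40 * sampleConst K ^ 4 * √(L * Real.log n / n) ≤ 1)
    (hω : 40 * sampleConst K ^ 4 * (ω₂ * √L) ≤ 1) (hA : ErrorBounds P SW ω₁ ω₂ D A) :
    IsPerturbedFit (sampleConst K) (√(L * Real.log n / n)) ω₂ P M SW D A := by
  have hS := h.mono h.le_sampleConst_self
  have hL : √(L : ℝ) ^ 2 = L := Real.sq_sqrt L.cast_nonneg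
  exact
    { one_le := hS.one_le
      card_eq := by rw [hL, Fintype.card_fin]
      one_le_sqrt_card := Real.one_le_sqrt.2 (mod_cast h.card_pos)
      delta_nonneg := Real.sqrt_nonneg _
      delta_le := hδ
      omega_le := hω
      weight_pos := h.classProb_pos
      weight_inv_le := by simpa only [hL] using hS.classProb_inv_le
      weight_le := by simpa only [hL] using hS.classProb_le
      posSemidef := discGram_posSemidef h.posDef M
      gram_le := hS.discGram_le
      weight_sub_le := by simpa only [hL] using hD.abs_frequency_sub_le h hn
      moment_le := hD.abs_momentPerturbation_le h hn
      error_le := by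
        rw [scaledFeat, Matrix.smul_mul, frobNorm_smul, abs_of_nonneg (by positivity)]
        exact (le_max_left _ _).trans hA.1 }

theorem isUnit_plugH_and_errQ_le (hD : IsTypicalSample K P M SW D)
    (h : IsBalancedLDAModel K P M SW) (hn : 3 ≤ n)
    (hδ : 40 * sampleConst K ^ 4 * √(L * Real.log n / n) ≤ 1)
    (hω : 40 * sampleConst K ^ 4 * (ω₂ * √L) ≤ 1) (hA : ErrorBounds P SW ω₁ ω₂ D A) {Δ : ℝ}
    (hΔ : Δ ≤ K) :
    IsUnit (plugH D A) ∧ errQ SW M Δ D (discEst D A) ≤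
      2400 * sampleConst K ^ 11 * ((L : ℝ) ^ 2 * Real.log n ^ 2 / n +
        ω₂ ^ 2 * (L : ℝ) ^ 2 * Real.log n +
        ω₁ ^ 2 * (L : ℝ) ^ 3 * Real.log (max (n : ℝ) p) / n) := by
  have hfit := hD.isPerturbedFit h hn hδ hω hA
  exact ⟨h.isUnit_plugH hfit, h.errQ_discEst_le hn hfit (hΔ.trans h.le_sampleConst_self)
    (hD.abs_meanEst_sub_le h hn) (hD.abs_sum_discB_mul_meanEst_sub_le h) hA⟩

end IsTypicalSample

/-- The constant `c` of the sample size conditions: it makes the perturbations of a typical sample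
small enough for `PerturbedRegression`. -/
noncomputable def smallConst (K : ℝ) : ℝ := (1 / (40 * sampleConst K ^ 4)) ^ 2

namespace IsBalancedLDAModel

theorem one_le_sampleConst (h : IsBalancedLDAModel K P M SW) : 1 ≤ sampleConst K :=
  h.one_le.trans h.le_sampleConst_self

theorem mul_log_le (h : IsBalancedLDAModel K P M SW) (hlog : L * Real.log n ≤ smallConst K * n) :
    96 * K * (L * Real.log n) ≤ n := by
  have hK := h.one_le
  have hS := h.one_le_sampleConst
  have hconst : 96 * K * smallConst K ≤ 1 := by
    have : sampleConst K ≤ sampleConst K ^ 4 := le_self_pow₀ hS (by norm_num)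
    rw [smallConst, div_pow, one_pow, mul_one_div, div_le_one (by positivity)]
    nlinarith [le_sampleConst K]
  calc 96 * K * (L * Real.log n) ≤ 96 * K * (smallConst K * n) := by gcongr
    _ = 96 * K * smallConst K * n := by ring
    _ ≤ n := mul_le_of_le_one_left n.cast_nonneg hconst

theorem mul_sqrt_le_one (h : IsBalancedLDAModel K P M SW) (hn : 0 < n)
    (hlog : L * Real.log n ≤ smallConst K * n) :
    40 * sampleConst K ^ 4 * √(L * Real.log n / n) ≤ 1 := by
  have := h.one_le_sampleConst
  rw [← le_div_iff₀' (by positivity), Real.sqrt_le_left (by positivity),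
    div_le_iff₀ (Nat.cast_pos.2 hn)]
  exact hlog

theorem mul_mul_sqrt_le_one (h : IsBalancedLDAModel K P M SW) (hω : ω₂ * √L ≤ smallConst K) :
    40 * sampleConst K ^ 4 * (ω₂ * √L) ≤ 1 := by
  have hS := h.one_le_sampleConst
  rw [← le_div_iff₀' (by positivity)]
  refine hω.trans (pow_le_of_le_one (by positivity) ?_ two_ne_zero)
  rw [div_le_one (by positivity)]
  linarith [one_le_pow₀ hS (n := 4)]

theorem measureReal_errQ_discEst_le {Ω : Type*} [MeasurableSpace Ω] {μ : Measure Ω}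
    {D : Fin n → Ω → Obs p L} {Δ : ℝ} {Bhat : Ω → Matrix (Fin p) (Fin L) ℝ}
    (h : IsBalancedLDAModel K P M SW) (hn : 1 ≤ n) (hΔ : Δ ≤ K) (hD : ∀ i, HasLaw (D i) P μ)
    (hind : iIndepFun D μ) (hlog : L * Real.log n ≤ smallConst K * n)
    (hω : ω₂ * √L ≤ smallConst K)
    (hBhat : 1 - 1 / (n : ℝ) ≤ μ.real {ω | ErrorBounds P SW ω₁ ω₂ (fun i => D i ω) (Bhat ω)}) :
    1 - 2 / (n : ℝ) ≤ μ.real {ω |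
      IsUnit (plugH (fun i => D i ω) (Bhat ω)) ∧
      errQ SW M Δ (fun i => D i ω) (discEst (fun i => D i ω) (Bhat ω)) ≤
        2400 * sampleConst K ^ 11 * ((L : ℝ) ^ 2 * Real.log n ^ 2 / n +
          ω₂ ^ 2 * (L : ℝ) ^ 2 * Real.log n +
          ω₁ ^ 2 * (L : ℝ) ^ 3 * Real.log (max (n : ℝ) p) / n)} := by
  have := hind.isProbabilityMeasure
  have hn0 : (0 : ℝ) < n := Nat.cast_pos.2 hn
  obtain hn3 | hn3 := Nat.lt_or_ge n 3
  · have hn2 : (n : ℝ) ≤ 2 := mod_cast Nat.le_of_lt_succ hn3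
    exact (sub_nonpos.2 ((one_le_div hn0).2 hn2)).trans measureReal_nonneg
  have hatypical := h.measureReal_not_isTypicalSample_le hn3 hD hind (h.mul_log_le hlog)
  calc 1 - 2 / (n : ℝ) = 1 - 1 / n - 1 / n := by ring
    _ ≤ μ.real {ω | ErrorBounds P SW ω₁ ω₂ (fun i => D i ω) (Bhat ω)} -
        μ.real {ω | ¬ IsTypicalSample K P M SW fun i => D i ω} := sub_le_sub hBhat hatypical
    _ ≤ μ.real ({ω | ErrorBounds P SW ω₁ ω₂ (fun i => D i ω) (Bhat ω)} \
        {ω | ¬ IsTypicalSample K P M SW fun i => D i ω}) := le_measureReal_sdiff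
    _ ≤ _ := measureReal_mono fun ω hmem =>
        (not_not.1 hmem.2).isUnit_plugH_and_errQ_le h hn3 (h.mul_sqrt_le_one hn hlog)
          (h.mul_mul_sqrt_le_one hω) hmem.1 hΔ

end IsBalancedLDAModel

theorem IsLDAModel.isBalancedLDAModel (hP : IsLDAModel P M SW) {cπ Cπ Cs CΔ CW Δ : ℝ}
    (hcπ : 0 < cπ) (hCs : 0 ≤ Cs) (hK : 1 ≤ K) (hcK : cπ⁻¹ ≤ K) (hCK : Cπ ≤ K)
    (hsK : Cs * CΔ ≤ K) (hWK : CW ≤ K)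
    (hprob : ∀ ℓ, cπ / L ≤ classProb P ℓ ∧ classProb P ℓ ≤ Cπ / L)
    (hmahal : ∀ k ℓ, k ≠ ℓ → mahal SW M k ℓ ≤ Cs * Δ) (hΔ : Δ ≤ CΔ) (hSW : ∀ j, SW j j ≤ CW) :
    IsBalancedLDAModel K P M SW where
  toIsLDAModel := hP
  one_le := hK
  classProb_inv_le ℓ := by
    have hL : (0 : ℝ) < L := mod_cast hP.card_pos
    calc (classProb P ℓ)⁻¹ ≤ (cπ / L)⁻¹ := inv_anti₀ (by positivity) (hprob ℓ).1
      _ = cπ⁻¹ * L := by rw [inv_div, div_eq_inv_mul]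
      _ ≤ K * L := by gcongr
  classProb_le ℓ := (hprob ℓ).2.trans (by gcongr)
  discGram_le := by
    refine hP.abs_discGram_le fun k ℓ => ?_
    obtain rfl | hkℓ := eq_or_ne k ℓ
    · rw [mahal_eq hP.posDef]
      linarith
    · exact (hmahal k ℓ hkℓ).trans ((mul_le_mul_of_nonneg_left hΔ hCs).trans hsK)
  variance_le j := (hSW j).trans hWK

end PlugInEstimator

end LDARegression

theorem theorem3_general {cπ Cπ Cs CΔ CW : ℝ} (hcπ : 0 < cπ) (hCs : 0 ≤ Cs) :
    ∃ c : ℝ, 0 < c ∧ ∃ C : ℝ, 0 < C ∧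
      ∀ (n p L : ℕ), 1 ≤ n →
      ∀ (P : Measure (Obs p L)) (M : Matrix (Fin p) (Fin L) ℝ)
        (SW : Matrix (Fin p) (Fin p) ℝ) (Δ : ℝ),
      IsLDAModel P M SW →
      (∀ ℓ : Fin L, cπ / L ≤ classProb P ℓ ∧ classProb P ℓ ≤ Cπ / L) →
      (∀ k ℓ : Fin L, k ≠ ℓ → mahal SW M k ℓ ≤ Cs * Δ) → Δ ≤ CΔ →
      (∀ j, SW j j ≤ CW) →
      (L : ℝ) * Real.log n ≤ c * n →
      ∀ (Ω : Type*) [MeasurableSpace Ω] (μ : Measure Ω) (D : Fin n → Ω → Obs p L),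
      (∀ i, HasLaw (D i) P μ) → iIndepFun D μ →
      ∀ (Bhat : Ω → Matrix (Fin p) (Fin L) ℝ) (ω₁ ω₂ : ℝ),
      1 - 1 / (n : ℝ) ≤ μ.real {ω | ErrorBounds P SW ω₁ ω₂ (fun i => D i ω) (Bhat ω)} →
      ω₂ * Real.sqrt L ≤ c →
      1 - 2 / (n : ℝ) ≤ μ.real {ω |
        IsUnit (plugH (fun i => D i ω) (Bhat ω)) ∧
        errQ SW M Δ (fun i => D i ω) (discEst (fun i => D i ω) (Bhat ω)) ≤
          C * ((L : ℝ) ^ 2 * Real.log n ^ 2 / n + ω₂ ^ 2 * (L : ℝ) ^ 2 * Real.log n +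
            ω₁ ^ 2 * (L : ℝ) ^ 3 * Real.log (max (n : ℝ) p) / n)} := by
  obtain ⟨K, hK⟩ := Finset.exists_le ({1, cπ⁻¹, Cπ, Cs * CΔ, CΔ, CW} : Finset ℝ)
  simp only [Finset.mem_insert, Finset.mem_singleton, forall_eq_or_imp, forall_eq] at hK
  obtain ⟨hK1, hcK, hCK, hsK, hΔK, hWK⟩ := hK
  have hS : 0 < sampleConst K := by linarith [le_sampleConst K]
  refine ⟨smallConst K, by rw [smallConst]; positivity, 2400 * sampleConst K ^ 11,
    by positivity, ?_⟩
  intro n p L hn P M SW Δ hP hprob hmahal hΔ hSW hlog Ω _ μ D hD hind Bhat ω₁ ω₂ hBhat hω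
  have hbalanced : IsBalancedLDAModel K P M SW :=
    hP.isBalancedLDAModel hcπ hCs hK1 hcK hCK hsK hWK hprob hmahal hΔ hSW
  exact hbalanced.measureReal_errQ_discEst_le hn (hΔ.trans hΔK) hD hind hlog hω hBhat

theorem theorem3
    -- the absolute constants of the standing assumptions
    (cπ Cπ cs Cs cΔ CΔ cW CW : ℝ)
    (hcπ : 0 < cπ) (hcπCπ : cπ ≤ Cπ) (hcs : 0 < cs) (hcsCs : cs ≤ Cs)
    (hcΔ : 0 < cΔ) (hcΔCΔ : cΔ ≤ CΔ) (hcW : 0 < cW) (hcWCW : cW ≤ CW) :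
    -- the small constant `c` and the constant `C` of the bound depend on these only
    ∃ c : ℝ, 0 < c ∧ ∃ C : ℝ, 0 < C ∧
      ∀ (n p L : ℕ), 1 ≤ n → 2 ≤ L →
      ∀ (P : Measure (Obs p L)) (M : Matrix (Fin p) (Fin L) ℝ)
        (SW : Matrix (Fin p) (Fin p) ℝ) (Δ : ℝ),
      IsLDAModel P M SW →
      -- the class probabilities are balanced
      (∀ ℓ : Fin L, cπ / L ≤ classProb P ℓ ∧ classProb P ℓ ≤ Cπ / L) →
      -- the classes are separated at the level `Δ`, and `Δ` is of constant order
      (∀ k ℓ : Fin L, k ≠ ℓ → cs * Δ ≤ mahal SW M k ℓ ∧ mahal SW M k ℓ ≤ Cs * Δ) →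
      cΔ ≤ Δ → Δ ≤ CΔ →
      -- the eigenvalues of `SW` are bounded below and its entries are bounded
      (∀ t ∈ spectrum ℝ SW, cW < t) → (∀ i j, |SW i j| ≤ CW) →
      (L : ℝ) * Real.log n ≤ c * n →
      -- the training data: `n` independent copies of `(X, Y)`
      ∀ (Ω : Type*) [MeasurableSpace Ω] (μ : Measure Ω) [IsProbabilityMeasure μ]
        (D : Fin n → Ω → Obs p L),
      (∀ i, HasLaw (D i) P μ) → iIndepFun D μ →
      -- any estimator of `B` with the required error bounds
      ∀ (Bhat : Ω → Matrix (Fin p) (Fin L) ℝ), (∀ j ℓ, Measurable fun ω => Bhat ω j ℓ) →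
      ∀ ω₁ ω₂ : ℝ,
      1 - 1 / (n : ℝ) ≤ μ.real {ω | ErrorBounds P SW ω₁ ω₂ (fun i => D i ω) (Bhat ω)} →
      ω₂ * Real.sqrt L ≤ c →
      1 - 2 / (n : ℝ) ≤ μ.real {ω |
        IsUnit (plugH (fun i => D i ω) (Bhat ω)) ∧
        errQ SW M Δ (fun i => D i ω) (discEst (fun i => D i ω) (Bhat ω)) ≤
          C * ((L : ℝ) ^ 2 * Real.log n ^ 2 / n + ω₂ ^ 2 * (L : ℝ) ^ 2 * Real.log n +
            ω₁ ^ 2 * (L : ℝ) ^ 3 * Real.log (max (n : ℝ) p) / n)} := by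
  obtain ⟨c, hc, C, hC, h⟩ := theorem3_general (Cπ := Cπ) (CΔ := CΔ) (CW := CW) hcπ
    (hcs.le.trans hcsCs)
  exact ⟨c, hc, C, hC, fun n p L hn _ P M SW Δ hP hprob hmahal _ hΔ _ hSW hlog Ω _ μ _ D hD hind
    Bhat _ => h n p L hn P M SW Δ hP hprob (fun k ℓ hkℓ => (hmahal k ℓ hkℓ).2) hΔ
      (fun j => (le_abs_self _).trans (hSW j j)) hlog Ω μ D hD hind Bhat⟩
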